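/- Let $S$ be a finite set of primes (so $\infty\notin S$), let $d\ge 1$, $m\ge 0$ be integers and $n=d+m$. Write $\mathbb{Q}_S^k=\prod_{\nu\in S}\mathbb{Q}_\nu^k$ and $\mathbb{Z}_S^k=\prod_{\nu\in S}\mathbb{Z}_\nu^k$, and let $\mu_{S,d}$ be the Haar measure on $\mathbb{Q}_S^d$ with $\mu_{S,d}(\mathbb{Z}_S^d)=1$. For each $\nu\in S$ let $\mathcal{U}_\nu\subseteq\mathbb{Z}_\nu^d$ be open and let $\mathbf{f}_\nu:\mathcal{U}_\nu\to\mathbb{Z}_\nu^m$ be a $C^2$ map (in the sense of non-archimedean calculus: the iterated difference quotients of $\mathbf{f}_\nu$ up to order two extend continuously to the diagonal). For $T\subseteq S$ put $\mathcal{U}_T=\prod_{\nu\in T}\mathcal{U}_\nu$, $\mathbf{F}_T(\mathbf{x})=(\mathbf{x}_\nu,\mathbf{f}_\nu(\mathbf{x}_\nu))_{\nu\in T}$ and $\mathcal{M}_\nu=\{(\mathbf{x}_\nu,\mathbf{f}_\nu(\mathbf{x}_\nu)):\mathbf{x}_\nu\in\mathcal{U}_\nu\}$, so that $\mathbf{F}_T$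 parametrises $\prod_{\nu\in T}\mathcal{M}_\nu$; put $\mathcal{U}=\mathcal{U}_S$, $\mathbf{F}=\mathbf{F}_S$. For positive reals $\boldsymbol{\tau}=(\tau_{i,\nu})_{1\le i\le n,\,\nu\in S}$ and $c>0$ let $W(c;\boldsymbol\tau)$ be the set of $\mathbf{y}\in\mathbb{Z}_S^n$ such that $$|b_0y_{i,\nu}-b_i|_\nu<c\,\|\mathbf{b}\|_\infty^{-\tau_{i,\nu}}\qquad(1\le i\le n,\ \nu\in S)$$ for infinitely many $\mathbf{b}=(b_0,\dots,b_n)\in\mathbb{Z}^{n+1}$, where $\|\mathbf{b}\|_\infty=\max_{0\le i\le n}|b_i|$, and let $\mathbf{Bad}^{(S)}_n(\boldsymbol\tau)=\mathbb{Z}_S^n\setminus\bigcap_{\ell\ge1}W(1/\ell;\boldsymbol\tau)$. For $T\subseteq S$ and positive weights $\boldsymbol{\rho}=(\rho_{i,\nu})_{1\le i\le n,\,\nu\in T}$ with $\sum_{i=1}^n\sum_{\nu\in T}\rho_{i,\nu}=n+1$, let, for $\mathbf{y}\in\mathbb{Q}_T^n$, $$\omega_{\boldsymbol\rho}(\mathbf{y})=\sup\Big\{\omega\in\mathbb{R}:\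 \max_{i,\nu}|b_0y_{i,\nu}+b_i|_\nu^{1/\rho_{i,\nu}}\le\|\mathbf{b}\|_\infty^{-\omega}\text{ for infinitely many }\mathbf{b}\in\mathbb{Z}^{n+1}\Big\},$$ and let the Diophantine exponent of $\prod_{\nu\in T}\mathcal{M}_\nu$ be the essential supremum $$\omega_{\boldsymbol\rho}\Big(\prod_{\nu\in T}\mathcal{M}_\nu\Big)=\inf\big\{\omega:\ \omega_{\boldsymbol\rho}(\mathbf{F}_T(\mathbf{x}))\le\omega\text{ for }\mu_{T,d}\text{-almost every }\mathbf{x}\in\mathcal{U}_T\big\}\in[-\infty,+\infty].$$ The manifold $\prod_{\nu\in T}\mathcal{M}_\nu$ is called strongly extremal if this exponent equals $1$ for all positive weights $\boldsymbol\rho$ with $\sum_{i}\sum_{\nu\in T}\rho_{i,\nu}=n+1$ and $\sum_{\nu\in T}\rho_{i,\nu}>1$ for each $1\le i\le n$. **Theorem.** Let $\boldsymbol\tau=(\tau_{i,\nu})_{1\le i\le n,\,\nu\in S}$ be positive reals satisfying $$\sum_{i=1}^n\sum_{\nu\in S}\tau_{i,\nu}=n+1,\qquad \min_{1\le i\le d}\tau_{i,\nu}\ge\max_{1\le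 j\le m}\tau_{d+j,\nu}\ (\nu\in S),\qquad \frac1{n+1}\sum_{i=1}^n\tau_{i,\nu}<\tau_{j,\nu}\ (1\le j\le n,\ \nu\in S).$$ For $\nu\in S$ define weights $\boldsymbol\tau^\nu$ over $S\setminus\{\nu\}$ by $\tau^\nu_{i,\sigma}=\tau_{i,\sigma}\Big/\Big(1-\frac1{n+1}\sum_{k=1}^n\tau_{k,\nu}\Big)$. (1) Suppose that for every $\nu\in S$ with $\min_{1\le i\le n}\tau_{i,\nu}\le1$ we have $$\omega_{\boldsymbol\tau^\nu}\Big(\prod_{\sigma\in S\setminus\{\nu\}}\mathcal{M}_\sigma\Big)<\frac{1-\frac1{n+1}\sum_{i=1}^n\tau_{i,\nu}}{1-\min_{1\le i\le n}\tau_{i,\nu}},$$ where the right-hand side is read as $+\infty$ if $\min_i\tau_{i,\nu}=1$. Then $\mu_{S,d}\big(\mathbf{F}^{-1}(\mathbf{Bad}^{(S)}_n(\boldsymbol\tau))\big)=0$. (2) Suppose that for every $\nu\in S$ with $\min_{1\le i\le n}\tau_{i,\nu}\le1$ the manifold $\prod_{\sigma\in S\setminus\{\nu\}}\mathcal{M}_\sigma$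 is strongly extremal. Then $\mu_{S,d}\big(\mathbf{F}^{-1}(\mathbf{Bad}^{(S)}_n(\boldsymbol\tau))\big)=0$. -/

import Mathlib

open MeasureTheory

noncomputable section

namespace SArith

instance instFactPrime (ν : Nat.Primes) : Fact (ν : ℕ).Prime := ⟨ν.2⟩

instance instMeasurableSpacePadic (ν : Nat.Primes) : MeasurableSpace ℚ_[(ν : ℕ)] := borel _

instance instBorelSpacePadic (ν : Nat.Primes) : BorelSpace ℚ_[(ν : ℕ)] := ⟨rfl⟩

/-! ### `C²` maps over a valued field

Over a non-archimedean field the mere existence and continuity of derivatives is too weak (it does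
not give a Taylor formula); the standard notion asks that the iterated difference quotients extend
continuously to the diagonal. -/

section Calculus

variable (K : Type*) {E F : Type*} [Field K] [TopologicalSpace K]
  [AddCommGroup E] [Module K E] [TopologicalSpace E]
  [AddCommGroup F] [Module K F] [TopologicalSpace F]

/-- The domain `{(x, v, t) : x ∈ U, x + t v ∈ U}` of the extended difference quotient. -/
def diffQuotDomain (U : Set E) : Set (E × E × K) :=
  {z | z.1 ∈ U ∧ z.1 + z.2.2 • z.2.1 ∈ U}

/-- `g` is a continuous extension, to all `(x, v, t)` including `t = 0`, of the difference quotient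
`(f (x + t v) - f x) / t`. -/
def IsDiffQuot (f : E → F) (U : Set E) (g : E × E × K → F) : Prop :=
  ContinuousOn g (diffQuotDomain K U) ∧
    ∀ x v t, (x, v, t) ∈ diffQuotDomain K U → f (x + t • v) - f x = t • g (x, v, t)

/-- `f` is `C¹` on the open set `U`: its difference quotient extends continuously. -/
def IsC1On (f : E → F) (U : Set E) : Prop :=
  ∃ g : E × E × K → F, IsDiffQuot K f U g

/-- `f` is `C²` on the open set `U`: its difference quotient extends to a `C¹` map. -/
def IsC2On (f : E → F) (U : Set E) : Prop :=
  ∃ g : E × E × K → F, IsDiffQuot K f U g ∧ IsC1On K g (diffQuotDomain K U)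

end Calculus

/-! ### The `S`-arithmetic space and its Haar measure, `∞ ∉ S` -/

/-- `ℚ_S^n`, the product over `ν ∈ S` of `ℚ_ν^n`. -/
abbrev QS (S : Finset Nat.Primes) (n : ℕ) : Type := ∀ ν : S, Fin n → ℚ_[(ν.1 : ℕ)]

/-- The closed unit ball `ℤ_ν` of `ℚ_ν`. -/
def unitBall (ν : Nat.Primes) : TopologicalSpace.PositiveCompacts ℚ_[(ν : ℕ)] where
  carrier := Metric.closedBall 0 1
  isCompact' := isCompact_closedBall 0 1
  interior_nonempty' :=
    ⟨0, interior_mono Metric.ball_subset_closedBall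
      (by rw [Metric.isOpen_ball.interior_eq]; exact Metric.mem_ball_self one_pos)⟩

/-- The Haar measure `μ_{S,d}` on `ℚ_S^d` giving mass `1` to `ℤ_S^d`. -/
def haar (S : Finset Nat.Primes) (d : ℕ) : Measure (QS S d) :=
  Measure.pi fun ν : S => Measure.pi fun _ : Fin d => Measure.addHaarMeasure (unitBall ν.1)

/-- `ℤ_S^n`. -/
def ZS (S : Finset Nat.Primes) (n : ℕ) : Set (QS S n) := {y | ∀ ν i, ‖y ν i‖ ≤ 1}

/-! ### Badly approximable points -/

/-- Points `y ∈ ℤ_S^n` with `|b₀ y_{i,ν} - b_i|_ν < c ‖b‖_∞ ^ (-τ_{i,ν})` for all `i`, `ν`, for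
infinitely many integer vectors `b = (b₀, …, b_n)`; `‖b‖` is the maximum norm. -/
def W (S : Finset Nat.Primes) {n : ℕ} (τ : Nat.Primes → Fin n → ℝ) (c : ℝ) : Set (QS S n) :=
  {y | y ∈ ZS S n ∧ {b : Fin (n + 1) → ℤ | ∀ (ν : S) (i : Fin n),
    ‖(b 0 : ℚ_[(ν.1 : ℕ)]) * y ν i - (b i.succ : ℚ_[(ν.1 : ℕ)])‖ <
      c * ‖b‖ ^ (-τ ν.1 i)}.Infinite}

/-- The `τ`-badly approximable points `Bad_n^{(S)}(τ) = ℤ_S^n \ ⋂_{ℓ ≥ 1} W(1/ℓ, τ)`. -/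
def Bad (S : Finset Nat.Primes) {n : ℕ} (τ : Nat.Primes → Fin n → ℝ) : Set (QS S n) :=
  ZS S n \ ⋂ ℓ : ℕ, W S τ (1 / ((ℓ : ℝ) + 1))

/-! ### Weights -/

/-- Positivity of the weights, and the normalisation `∑_i ∑_{ν ∈ S} τ_{i,ν} = n + 1`. -/
def IsWeight (S : Finset Nat.Primes) {n : ℕ} (τ : Nat.Primes → Fin n → ℝ) : Prop :=
  (∀ ν ∈ S, ∀ i, 0 < τ ν i) ∧ ∑ i, ∑ ν ∈ S, τ ν i = (n : ℝ) + 1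

/-- The rescaled weights `τ^ν_{i,σ} = τ_{i,σ} / (1 - (∑_i τ_{i,ν}) / (n + 1))`. -/
def rescale {n : ℕ} (τ : Nat.Primes → Fin n → ℝ) (ν : Nat.Primes) : Nat.Primes → Fin n → ℝ :=
  fun σ i => τ σ i / (1 - (∑ k, τ ν k) / ((n : ℝ) + 1))

/-! ### Diophantine exponents -/

/-- `ω_τ(y)`: the supremum of the real `ω` such that
`max_{i,ν} |b₀ y_{i,ν} + b_i|_ν ^ (1/τ_{i,ν}) ≤ ‖b‖_∞ ^ (-ω)` for infinitely many integer
vectors `b`. -/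
def exponent (S : Finset Nat.Primes) {n : ℕ} (τ : Nat.Primes → Fin n → ℝ) (y : QS S n) : EReal :=
  ⨆ ω ∈ {ω : ℝ | {b : Fin (n + 1) → ℤ | ∀ (ν : S) (i : Fin n),
    ‖(b 0 : ℚ_[(ν.1 : ℕ)]) * y ν i + (b i.succ : ℚ_[(ν.1 : ℕ)])‖ ^ (1 / τ ν.1 i) ≤
      ‖b‖ ^ (-ω)}.Infinite}, (ω : EReal)

/-- `𝒰 = ∏_{ν ∈ S} 𝒰_ν`. -/
def domain (S : Finset Nat.Primes) {d : ℕ}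
    (U : ∀ ν : Nat.Primes, Set (Fin d → ℚ_[(ν : ℕ)])) : Set (QS S d) :=
  {x | ∀ ν : S, x ν ∈ U ν.1}

/-- The parametrisation `F(x) = (x_ν, f_ν(x_ν))_{ν ∈ S}` of `∏_{ν ∈ S} M_ν`. -/
def param (S : Finset Nat.Primes) {d m : ℕ}
    (f : ∀ ν : Nat.Primes, (Fin d → ℚ_[(ν : ℕ)]) → (Fin m → ℚ_[(ν : ℕ)])) (x : QS S d) :
    QS S (d + m) :=
  fun ν => Fin.append (x ν) (f ν.1 (x ν))

/-- The Diophantine exponent of `∏_{ν ∈ S} M_ν`: the essential supremum of `ω_τ(F(x))`, that is the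
infimum of all `ω` with `ω_τ(F(x)) ≤ ω` for almost every `x ∈ 𝒰`. -/
def manifoldExponent (S : Finset Nat.Primes) {d m : ℕ}
    (U : ∀ ν : Nat.Primes, Set (Fin d → ℚ_[(ν : ℕ)]))
    (f : ∀ ν : Nat.Primes, (Fin d → ℚ_[(ν : ℕ)]) → (Fin m → ℚ_[(ν : ℕ)]))
    (τ : Nat.Primes → Fin (d + m) → ℝ) : EReal :=
  sInf {ω : EReal | ∀ᵐ x ∂(haar S d), x ∈ domain S U → exponent S τ (param S f x) ≤ ω}

/-- `∏_{ν ∈ S} M_ν` is strongly extremal: its exponent is `1` for all admissible weights, i.e. all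
positive normalised weights with `∑_{ν ∈ S} τ_{i,ν} > 1` for every `i`. -/
def StronglyExtremal (S : Finset Nat.Primes) {d m : ℕ}
    (U : ∀ ν : Nat.Primes, Set (Fin d → ℚ_[(ν : ℕ)]))
    (f : ∀ ν : Nat.Primes, (Fin d → ℚ_[(ν : ℕ)]) → (Fin m → ℚ_[(ν : ℕ)])) : Prop :=
  ∀ τ : Nat.Primes → Fin (d + m) → ℝ, IsWeight S τ → (∀ i, 1 < ∑ ν ∈ S, τ ν i) →
    manifoldExponent S U f τ = 1

/-- The bound `(1 - (∑_i τ_{i,ν}) / (n + 1)) / (1 - min_i τ_{i,ν})`, read as `+∞` when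
`min_i τ_{i,ν} = 1`. It is only used when `min_i τ_{i,ν} ≤ 1`. -/
def exponentBound {n : ℕ} (τ : Nat.Primes → Fin n → ℝ) (ν : Nat.Primes) : EReal :=
  if (⨅ i, τ ν i) < 1 then
    (((1 - (∑ i, τ ν i) / ((n : ℝ) + 1)) / (1 - ⨅ i, τ ν i) : ℝ) : EReal)
  else ⊤

end SArith

end

/-
Dirichlet's pigeonhole argument, applied at `F(x)` to the linear forms sheared along the derivative
of `F`, gives infinitely many integer vectors `b` for which all the residuals
`b₀ y_{i,ν} - b_i` are small: the first `d` of them up to a constant `C`, the others up to an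
arbitrarily small constant once the tangential part is subtracted. If `b₀` were `ν`-adically very
small for infinitely many of these, all entries of `b` would be divisible by a high power of `ν`;
dividing it out gives unusually good approximations at the primes of `S \ {ν}`, which the bound on
the exponent forbids almost everywhere. So `b₀` is not too small, and then, by Taylor's formula,
the last `m` inequalities with constant `ε` hold over the whole box around `(b_i / b₀)_{i ≤ d}` on
which the first `d` hold with a small constant `η`. Almost every point lying in infinitely many of
the boxes of constant `C` lies in infinitely many of the boxes of constant `η`, by the Lebesgue
density theorem applied one coordinate at a time; such a point is in `W ε`.
-/

noncomputable section

namespace SArith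

open Filter Topology Metric
open scoped Pointwise

section LimsupSets

theorem isUnifLocDoublingMeasure_of_isAddHaarMeasure {K : Type*} [NontriviallyNormedField K]
    [LocallyCompactSpace K] [MeasurableSpace K] [BorelSpace K] (μ : Measure K)
    [μ.IsAddHaarMeasure] [μ.Regular] : IsUnifLocDoublingMeasure μ where
  exists_measure_closedBall_le_mul'' := by
    obtain ⟨c, hc⟩ := NormedField.exists_lt_norm K 2
    have hc0 : c ≠ 0 := norm_pos_iff.1 (two_pos.trans hc)
    have hsmul (ε : ℝ) : Units.mk0 c hc0 • closedBall (0 : K) ε = closedBall 0 (‖c‖ * ε) :=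
      (smul_closedBall' hc0 0 ε).trans (by rw [smul_zero])
    refine ⟨distribHaarChar K (Units.mk0 c hc0), ?_⟩
    filter_upwards [self_mem_nhdsWithin] with ε (hε : 0 < ε) x
    rw [Measure.addHaar_closedBall_center μ x (2 * ε), Measure.addHaar_closedBall_center μ x ε,
      distribHaarChar_mul, hsmul]
    exact measure_mono (closedBall_subset_closedBall (by gcongr))

instance isUnifLocDoublingMeasure_padic (ν : Nat.Primes) :
    IsUnifLocDoublingMeasure (Measure.addHaarMeasure (unitBall ν)) :=
  isUnifLocDoublingMeasure_of_isAddHaarMeasure _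

variable {κ : Type*}

/-- For every set `P` of indices, almost every point which lies in infinitely many of the sets
`T k` with `k ∈ P` lies in infinitely many of the sets `B k` with `k ∈ P`. Quantifying over `P`
makes this stable under products. -/
def ShrinksAE {α : Type*} [MeasurableSpace α] (μ : Measure α) (T B : κ → Set α) : Prop :=
  ∀ P : Set κ, ∀ᵐ x ∂μ, {k ∈ P | x ∈ T k}.Infinite → {k ∈ P | x ∈ B k}.Infinite

theorem ShrinksAE.refl {α : Type*} [MeasurableSpace α] (μ : Measure α) (T : κ → Set α) :
    ShrinksAE μ T T :=
  fun _ => .of_forall fun _ => id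

theorem ShrinksAE.trans {α : Type*} [MeasurableSpace α] {μ : Measure α} {T B C : κ → Set α}
    (hTB : ShrinksAE μ T B) (hBC : ShrinksAE μ B C) : ShrinksAE μ T C := fun P => by
  filter_upwards [hTB P, hBC P] with x hx hx' using hx' ∘ hx

variable [Countable κ]

theorem shrinksAE_closedBall {α : Type*} [PseudoMetricSpace α] [MeasurableSpace α]
    [SecondCountableTopology α] [BorelSpace α] (μ : Measure α) [IsUnifLocDoublingMeasure μ]
    [IsLocallyFiniteMeasure μ] (w : κ → α) {r : κ → ℝ} (hr : Tendsto r cofinite (𝓝 0))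
    (hr0 : ∀ k, 0 ≤ r k) {A : ℝ} (hA : 0 < A) :
    ShrinksAE μ (fun k => closedBall (w k) (A * r k)) (fun k => closedBall (w k) (r k)) := by
  intro P
  rcases finite_or_infinite κ with hκ | hκ
  · exact .of_forall fun x h => absurd (Set.toFinite _) h
  obtain ⟨e⟩ := nonempty_equiv_of_countable (α := ℕ) (β := κ)
  have hblimsup := blimsup_cthickening_mul_ae_eq μ (fun n => e n ∈ P) (fun n => {w (e n)}) hA
    (fun n => r (e n)) (hr.comp (Nat.cofinite_eq_atTop ▸ e.injective.tendsto_cofinite))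
  have hinf (R : κ → ℝ) (x : α) : {n | e n ∈ P ∧ x ∈ closedBall (w (e n)) (R (e n))}.Infinite ↔
      {k ∈ P | x ∈ closedBall (w k) (R k)}.Infinite :=
    not_congr (Equiv.set_finite_iff (e.subtypeEquiv fun _ => Iff.rfl))
  simp_rw [cthickening_singleton _ (mul_nonneg hA.le (hr0 _)), cthickening_singleton _ (hr0 _),
    ← Nat.cofinite_eq_atTop, cofinite.blimsup_set_eq] at hblimsup
  filter_upwards [hblimsup.mem_iff] with x hx h
  exact (hinf r x).1 (hx.1 ((hinf (fun k => A * r k) x).2 h))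

theorem measurableSet_infinite_setOf_mem {α : Type*} [MeasurableSpace α] {T : κ → Set α}
    (hT : ∀ k, MeasurableSet (T k)) (P : Set κ) :
    MeasurableSet {x | {k ∈ P | x ∈ T k}.Infinite} := by
  have heq : {x | {k ∈ P | x ∈ T k}.Infinite} = ⋂ F : Finset κ, ⋃ k ∈ P \ F, T k := by
    ext x
    simp only [Set.mem_ofPred_eq, Set.mem_iInter, Set.mem_iUnion]
    constructor
    · intro h F
      obtain ⟨k, hk, hkF⟩ := h.exists_notMem_finset F
      exact ⟨k, ⟨hk.1, hkF⟩, hk.2⟩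
    · intro h hfin
      obtain ⟨k, ⟨hkP, hkF⟩, hk⟩ := h hfin.toFinset
      exact hkF (by simpa using ⟨hkP, hk⟩)
  rw [heq]
  exact .iInter fun F => .biUnion (Set.to_countable _) fun k _ => hT k

end LimsupSets

section Slices

variable {ι : Type*} [Fintype ι] {X : ι → Type*} [∀ i, MeasurableSpace (X i)]
  (μ : ∀ i, Measure (X i)) [∀ i, SigmaFinite (μ i)]

theorem ae_pi_of_ae_update [DecidableEq ι] (i : ι) {p : (∀ i, X i) → Prop}
    (hp : MeasurableSet {x | p x}) (h : ∀ x, ∀ᵐ t ∂μ i, p (Function.update x i t)) :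
    ∀ᵐ x ∂Measure.pi μ, p x := by
  have hlint : ∫⁻ x, {x | p x}ᶜ.indicator 1 x ∂Measure.pi μ = ∫⁻ _, 0 ∂Measure.pi μ := by
    refine lintegral_eq_of_lmarginal_eq {i} (measurable_one.indicator hp.compl)
      measurable_const (funext fun x => ?_)
    rw [lmarginal_singleton, lmarginal_singleton, lintegral_zero]
    exact (lintegral_indicator_one (measurable_update x hp.compl)).trans (h x)
  rwa [lintegral_indicator_one hp.compl, lintegral_zero] at hlint

variable {μ} {κ : Type*} [Countable κ] {T B : ∀ i, κ → Set (X i)}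

theorem ShrinksAE.pi_update [DecidableEq ι] {j : ι} {C : κ → Set (X j)}
    (hT : ∀ i k, MeasurableSet (T i k)) (hC : ∀ k, MeasurableSet (C k))
    (h : ShrinksAE (μ j) (T j) C) :
    ShrinksAE (Measure.pi μ) (fun k => Set.univ.pi fun i => T i k)
      (fun k => Set.univ.pi fun i => Function.update T j C i k) := by
  intro P
  have hC' : ∀ i k, MeasurableSet (Function.update T j C i k) :=
    (Function.forall_update_iff T fun i s => ∀ k, MeasurableSet (s k)).2 ⟨hC, fun i _ => hT i⟩
  refine ae_pi_of_ae_update μ j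
    ((measurableSet_infinite_setOf_mem (fun k => .univ_pi (hT · k)) P).imp
      (measurableSet_infinite_setOf_mem (fun k => .univ_pi (hC' · k)) P)) fun x => ?_
  filter_upwards [h {k ∈ P | ∀ i ≠ j, x i ∈ T i k}] with t ht
  have hmem (R : κ → Set (X j)) (k : κ) :
      Function.update x j t ∈ Set.univ.pi (fun i => Function.update T j R i k) ↔
        t ∈ R k ∧ ∀ i ≠ j, x i ∈ T i k := by
    rw [Set.mem_univ_pi,
      Function.forall_update_iff x fun i y => y ∈ Function.update T j R i k, Function.update_self]
    exact and_congr_right' (forall₂_congr fun i hi => by rw [Function.update_of_ne hi])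
  have hset (R : κ → Set (X j)) :
      {k ∈ P | Function.update x j t ∈ Set.univ.pi fun i => Function.update T j R i k} =
        {k ∈ {k ∈ P | ∀ i ≠ j, x i ∈ T i k} | t ∈ R k} := by
    ext k
    rw [Set.mem_sep_iff, hmem]
    exact and_assoc.trans (and_congr_right' and_comm) |>.symm
  have hTj := hset (T j)
  rw [Function.update_eq_self] at hTj
  rwa [hTj, hset C]

theorem ShrinksAE.pi (hT : ∀ i k, MeasurableSet (T i k)) (hB : ∀ i k, MeasurableSet (B i k))
    (h : ∀ i, ShrinksAE (μ i) (T i) (B i)) :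
    ShrinksAE (Measure.pi μ) (fun k => Set.univ.pi fun i => T i k)
      (fun k => Set.univ.pi fun i => B i k) := by
  classical
  suffices H : ∀ s : Finset ι, ShrinksAE (Measure.pi μ) (fun k => Set.univ.pi fun i => T i k)
      (fun k => Set.univ.pi fun i => s.piecewise B T i k) by
    simpa using H Finset.univ
  intro s
  induction s using Finset.induction_on with
  | empty => simpa using ShrinksAE.refl _ _
  | insert j s hj ih =>
    rw [Finset.piecewise_insert]
    refine ih.trans (ShrinksAE.pi_update (fun i => ?_) (hB j) ?_)
    · exact s.piecewise_cases B T (fun A => ∀ k, MeasurableSet (A k)) (hB i) (hT i)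
    · rw [Finset.piecewise_eq_of_notMem _ _ _ hj]
      exact h j

end Slices

theorem shrinksAE_haar {κ : Type*} [Countable κ] {S : Finset Nat.Primes} {d : ℕ} (w : κ → QS S d)
    {r : κ → S → Fin d → ℝ} (hr : ∀ ν i, Tendsto (r · ν i) cofinite (𝓝 0))
    (hr0 : ∀ k ν i, 0 ≤ r k ν i) {A : ℝ} (hA : 0 < A) :
    ShrinksAE (haar S d)
      (fun k => Set.univ.pi fun ν => Set.univ.pi fun i => closedBall (w k ν i) (A * r k ν i))
      (fun k => Set.univ.pi fun ν => Set.univ.pi fun i => closedBall (w k ν i) (r k ν i)) :=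
  .pi (fun _ _ => .univ_pi fun _ => measurableSet_closedBall)
    (fun _ _ => .univ_pi fun _ => measurableSet_closedBall) fun ν =>
      .pi (fun _ _ => measurableSet_closedBall) (fun _ _ => measurableSet_closedBall) fun i =>
        shrinksAE_closedBall _ (w · ν i) (hr ν i) (hr0 · ν i) hA

section Dirichlet

theorem eventually_mul_rpow_neg_lt (B : ℝ) {ρ γ : ℝ} (hρ : 0 < ρ) (hγ : 0 < γ) :
    ∀ᶠ X : ℝ in atTop, B * X ^ (-ρ) < γ := by
  have hlim := (tendsto_rpow_neg_atTop hρ).const_mul B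
  rw [mul_zero] at hlim
  exact hlim.eventually_lt_const hγ

theorem eventually_mul_rpow_neg_lt_mul_rpow_neg (B : ℝ) {ρ μ γ : ℝ} (hμρ : μ < ρ) (hγ : 0 < γ) :
    ∀ᶠ X : ℝ in atTop, B * X ^ (-ρ) < γ * X ^ (-μ) := by
  filter_upwards [eventually_mul_rpow_neg_lt B (sub_pos.2 hμρ) hγ, eventually_gt_atTop 0]
    with X hX hX0
  have hsplit : X ^ (-ρ) = X ^ (-(ρ - μ)) * X ^ (-μ) := by
    rw [← Real.rpow_add hX0]
    ring_nf
  rw [hsplit, ← mul_assoc]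
  gcongr

theorem infinite_of_forall_exists_norm_lt {G V : Type*} [AddCommGroup G] [IsAddTorsionFree G]
    [NormedAddCommGroup V] (L : G →+ V) {A : Set G} (hA : ∀ b, L b = 0 → b ∈ A)
    (h : ∀ ε > 0, ∃ b ∈ A, b ≠ 0 ∧ ‖L b‖ < ε) : A.Infinite := by
  by_cases hker : ∃ b ≠ 0, L b = 0
  · obtain ⟨b, hb, hLb⟩ := hker
    exact (Set.infinite_range_of_injective (smul_left_injective ℤ hb)).mono
      (Set.range_subset_iff.2 fun n => hA _ (by rw [map_zsmul, hLb, smul_zero]))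
  · push Not at hker
    intro hfin
    have hpos : ∀ b ∈ A \ {0}, 0 < ‖L b‖ := fun b hb => norm_pos_iff.2 (hker b hb.2)
    obtain ⟨ε, hε, hlt⟩ : ∃ ε > 0, ∀ b ∈ A \ {0}, ε < ‖L b‖ :=
      ((Set.Finite.eventually_all (l := 𝓝[>] (0 : ℝ)) hfin.sdiff).2 fun b hb =>
        (eventually_lt_nhds (hpos b hb)).filter_mono nhdsWithin_le_nhds).and
        self_mem_nhdsWithin |>.exists.imp fun ε h => ⟨h.2, h.1⟩
    obtain ⟨b, hbA, hb, hlt'⟩ := h ε hε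
    exact (hlt b ⟨hbA, hb⟩).not_gt hlt'

variable {J : Type*} [Fintype J]

theorem exists_ne_zero_norm_le_map_eq_zero {A : Type*} [AddCommGroup A] [Finite A]
    (φ : (J → ℤ) →+ A) {H : ℕ} (hA : Nat.card A < (H + 1) ^ Fintype.card J) :
    ∃ b ≠ 0, ‖b‖ ≤ H ∧ φ b = 0 := by
  classical
  have := Fintype.ofFinite A
  let v : (J → Fin (H + 1)) → J → ℤ := fun a j => (a j : ℕ)
  obtain ⟨a, a', hne, heq⟩ := Fintype.exists_ne_map_eq_of_card_lt (φ ∘ v)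
    (by simpa [Nat.card_eq_fintype_card] using hA)
  refine ⟨v a - v a', sub_ne_zero.2 fun h => hne ?_, ?_, by rw [map_sub, sub_eq_zero]; exact heq⟩
  · exact funext fun j => Fin.ext (Int.natCast_inj.1 (congrFun h j))
  · refine (pi_norm_le_iff_of_nonneg H.cast_nonneg).2 fun j => ?_
    have hle : |v a j - v a' j| ≤ (H : ℤ) := by
      simp only [v, abs_le]
      omega
    rw [Pi.sub_apply, Int.norm_eq_abs]
    exact mod_cast hle

variable {ι : Type*} [Fintype ι] {p : ι → ℕ} [∀ k, Fact (p k).Prime]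

theorem exists_ne_zero_norm_padicInt_le (L : ∀ k, (J → ℤ) →+ ℤ_[p k]) {δ : ι → ℝ}
    (hδ0 : ∀ k, 0 < δ k) (hδ1 : ∀ k, δ k ≤ 1) {H : ℕ}
    (hprod : ∏ k, p k / δ k < ((H : ℝ) + 1) ^ Fintype.card J) :
    ∃ b ≠ 0, ‖b‖ ≤ H ∧ ∀ k, ‖L k b‖ ≤ δ k := by
  have hp : ∀ k, (1 : ℝ) < p k := fun k => by exact_mod_cast (Fact.out : (p k).Prime).one_lt
  have hp0 : ∀ k, (0 : ℝ) < p k := fun k => one_pos.trans (hp k)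
  choose e he hle using fun k => exists_nat_pow_near_of_lt_one (hδ0 k) (hδ1 k)
    (inv_pos.2 (hp0 k)) (inv_lt_one_of_one_lt₀ (hp k))
  have : ∀ k, NeZero (p k ^ (e k + 1)) := fun k =>
    ⟨pow_ne_zero _ (Fact.out : (p k).Prime).ne_zero⟩
  let φ : (J → ℤ) →+ ∀ k, ZMod (p k ^ (e k + 1)) := AddMonoidHom.mk'
    (fun b k => PadicInt.toZModPow (e k + 1) (L k b)) fun b b' => by ext; simp
  have hcard : Nat.card (∀ k, ZMod (p k ^ (e k + 1))) < (H + 1) ^ Fintype.card J := by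
    rw [Nat.card_pi]
    simp_rw [Nat.card_zmod]
    have hle' : ∀ k, (p k : ℝ) ^ (e k + 1) ≤ p k / δ k := fun k => by
      have := hle k
      rw [inv_pow, le_inv_comm₀ (hδ0 k) (pow_pos (hp0 k) _)] at this
      rw [pow_succ', div_eq_mul_inv]
      gcongr
    exact_mod_cast (Finset.prod_le_prod (fun k _ => by positivity) fun k _ => hle' k).trans_lt hprod
  obtain ⟨b, hb0, hbH, hb⟩ := exists_ne_zero_norm_le_map_eq_zero φ hcard
  refine ⟨b, hb0, hbH, fun k => le_trans ?_ (he k).le⟩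
  have hker : L k b ∈ RingHom.ker (PadicInt.toZModPow (e k + 1)) := congrFun hb k
  rw [PadicInt.ker_toZModPow, ← PadicInt.norm_le_pow_iff_mem_span_pow] at hker
  rwa [inv_pow, ← zpow_natCast, ← zpow_neg]

theorem exists_forall_norm_le_pow {J : Type*} [Finite J] {p : ℕ} [Fact p.Prime]
    (L : (J → ℤ) →+ ℚ_[p]) : ∃ M : ℕ, ∀ b, ‖L b‖ ≤ (p : ℝ) ^ M := by
  classical
  cases nonempty_fintype J
  have hp : (1 : ℝ) < p := by exact_mod_cast (Fact.out : p.Prime).one_lt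
  obtain ⟨M, hM⟩ := pow_unbounded_of_one_lt ‖fun j => L (Pi.single j 1)‖ hp
  refine ⟨M, fun b => ?_⟩
  rw [← Finset.univ_sum_single b, map_sum]
  refine IsUltrametricDist.norm_sum_le_of_forall_le_of_nonneg (by positivity) fun j _ => ?_
  have hsingle : L (Pi.single j (b j)) = b j * L (Pi.single j 1) := by
    rw [← zsmul_eq_mul, ← map_zsmul, ← Pi.single_smul, smul_eq_mul, mul_one]
  calc ‖L (Pi.single j (b j))‖ ≤ 1 * ‖L (Pi.single j 1)‖ := by
        rw [hsingle, norm_mul]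
        gcongr
        exact Padic.norm_int_le_one _
    _ ≤ (p : ℝ) ^ M := by
        rw [one_mul]
        exact (norm_le_pi_norm (fun j => L (Pi.single j 1)) j).trans hM.le

theorem exists_ne_zero_norm_padic_le {L : ∀ k, (J → ℤ) →+ ℚ_[p k]} {M : ι → ℕ}
    (hL : ∀ k b, ‖L k b‖ ≤ (p k : ℝ) ^ M k) {δ : ι → ℝ} (hδ0 : ∀ k, 0 < δ k)
    (hδM : ∀ k, δ k ≤ (p k : ℝ) ^ M k) {H : ℕ}
    (hprod : ∏ k, (p k : ℝ) ^ (M k + 1) / δ k < ((H : ℝ) + 1) ^ Fintype.card J) :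
    ∃ b ≠ 0, ‖b‖ ≤ H ∧ ∀ k, ‖L k b‖ ≤ δ k := by
  have hp : ∀ k, (0 : ℝ) < (p k : ℝ) ^ M k := fun k =>
    pow_pos (by exact_mod_cast (Fact.out : (p k).Prime).pos) _
  have hnorm : ∀ k b, ‖(p k : ℚ_[p k]) ^ M k * L k b‖ = ‖L k b‖ / (p k : ℝ) ^ M k := fun k b => by
    rw [norm_mul, norm_pow, Padic.norm_p, inv_pow, inv_mul_eq_div]
  let L' : ∀ k, (J → ℤ) →+ ℤ_[p k] := fun k => AddMonoidHom.mk'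
    (fun b => ⟨(p k : ℚ_[p k]) ^ M k * L k b,
      (hnorm k b).trans_le (div_le_one_of_le₀ (hL k b) (hp k).le)⟩)
    fun b b' => PadicInt.ext <| by
      simp only [map_add, mul_add]
      rfl
  obtain ⟨b, hb0, hbH, hb⟩ := exists_ne_zero_norm_padicInt_le L'
    (fun k => div_pos (hδ0 k) (hp k)) (fun k => div_le_one_of_le₀ (hδM k) (hp k).le) (H := H) (by
      simpa only [div_div_eq_mul_div, pow_succ'] using hprod)
  exact ⟨b, hb0, hbH, fun k =>
    (div_le_div_iff_of_pos_right (hp k)).1 ((hnorm k b).symm.trans_le (hb k))⟩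

theorem exists_eventually_exists_norm_padic_le (L : ∀ k, (J → ℤ) →+ ℚ_[p k]) {τ : ι → ℝ}
    (hτ : ∀ k, 0 < τ k) (hsum : ∑ k, τ k ≤ Fintype.card J) :
    ∃ B : ℝ, ∀ c : ι → ℝ, (∀ k, 0 < c k) → B < ∏ k, c k →
      ∀ᶠ H : ℕ in atTop, ∃ b ≠ 0, ‖b‖ ≤ H ∧ ∀ k, ‖L k b‖ ≤ c k * (H : ℝ) ^ (-τ k) := by
  choose M hM using fun k => exists_forall_norm_le_pow (L k)
  refine ⟨∏ k, (p k : ℝ) ^ (M k + 1), fun c hc hB => ?_⟩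
  have hsmall : ∀ᶠ H : ℕ in atTop, ∀ k, c k * (H : ℝ) ^ (-τ k) < (p k : ℝ) ^ M k :=
    tendsto_natCast_atTop_atTop.eventually (eventually_all.2 fun k =>
      eventually_mul_rpow_neg_lt (c k) (hτ k)
        (pow_pos (by exact_mod_cast (Fact.out : (p k).Prime).pos) _))
  filter_upwards [hsmall, eventually_ge_atTop 1] with H hsmall hH
  have hH0 : (0 : ℝ) < H := by exact_mod_cast hH
  refine exists_ne_zero_norm_padic_le hM
    (fun k => mul_pos (hc k) (Real.rpow_pos_of_pos hH0 _)) (fun k => (hsmall k).le) ?_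
  have hfactor : ∀ k, (p k : ℝ) ^ (M k + 1) / (c k * (H : ℝ) ^ (-τ k)) =
      (p k : ℝ) ^ (M k + 1) / c k * (H : ℝ) ^ τ k := fun k => by
    rw [Real.rpow_neg hH0.le, ← div_div, div_inv_eq_mul]
  calc ∏ k, (p k : ℝ) ^ (M k + 1) / (c k * (H : ℝ) ^ (-τ k))
      = (∏ k, (p k : ℝ) ^ (M k + 1)) / (∏ k, c k) * (H : ℝ) ^ ∑ k, τ k := by
        rw [Finset.prod_congr rfl fun k _ => hfactor k, Finset.prod_mul_distrib,
          Finset.prod_div_distrib, Real.rpow_sum_of_pos hH0]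
    _ < 1 * (H : ℝ) ^ (Fintype.card J : ℝ) := by
        refine mul_lt_mul ((div_lt_one (Finset.prod_pos fun k _ => hc k)).2 hB)
          (Real.rpow_le_rpow_of_exponent_le (mod_cast hH) hsum) (by positivity) zero_le_one
    _ ≤ _ := by
        rw [one_mul, Real.rpow_natCast]
        gcongr
        exact le_add_of_nonneg_right zero_le_one

theorem infinite_setOf_norm_padic_le (L : ∀ k, (J → ℤ) →+ ℚ_[p k]) {τ : ι → ℝ}
    (hτ : ∀ k, 0 < τ k) (hsum : ∑ k, τ k ≤ Fintype.card J) :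
    ∃ B : ℝ, ∀ c : ι → ℝ, (∀ k, 0 < c k) → B < ∏ k, c k →
      {b : J → ℤ | ∀ k, ‖L k b‖ ≤ c k * ‖b‖ ^ (-τ k)}.Infinite := by
  obtain ⟨B, hB⟩ := exists_eventually_exists_norm_padic_le L hτ hsum
  refine ⟨B, fun c hc hBc => infinite_of_forall_exists_norm_lt (AddMonoidHom.pi L)
    (fun b hb k => ?_) fun ε hε => ?_⟩
  · have : L k b = 0 := congrFun hb k
    rw [this, norm_zero]
    exact mul_nonneg (hc k).le (Real.rpow_nonneg (norm_nonneg _) _)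
  have hsmall : ∀ᶠ H : ℕ in atTop, ∀ k, c k * (H : ℝ) ^ (-τ k) < ε :=
    tendsto_natCast_atTop_atTop.eventually
      (eventually_all.2 fun k => eventually_mul_rpow_neg_lt (c k) (hτ k) hε)
  obtain ⟨H, ⟨b, hb0, hbH, hb⟩, hHε⟩ := ((hB c hc hBc).and hsmall).exists
  refine ⟨b, fun k => (hb k).trans ?_, hb0, (pi_norm_lt_iff hε).2 fun k => (hb k).trans_lt (hHε k)⟩
  have := (hc k).le
  gcongr ?_ * ?_
  exact Real.rpow_le_rpow_of_nonpos (norm_pos_iff.2 hb0) hbH (neg_nonpos.2 (hτ k).le)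

end Dirichlet

section Exponents

variable {S : Finset Nat.Primes} {n : ℕ}

/-- The linear forms `b₀ y_{i,ν} - b_i` in the integer vector `b`, whose smallness defines
`W`. -/
def residual (y : QS S n) : (Fin (n + 1) → ℤ) →+ QS S n :=
  AddMonoidHom.mk' (fun b ν i => b 0 * y ν i - b i.succ) fun b b' => by
    ext ν i
    simp only [Pi.add_apply, Int.cast_add]
    ring

theorem residual_apply (y : QS S n) (b : Fin (n + 1) → ℤ) (ν : S) (i : Fin n) :
    residual y b ν i = b 0 * y ν i - b i.succ :=
  rfl

/-- The projection of `ℚ_S^n` which drops the component at `ν`. -/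
def forget (ν : Nat.Primes) (y : QS S n) : QS (S.erase ν) n :=
  fun σ => y ⟨σ.1, Finset.mem_of_mem_erase σ.2⟩

theorem tendsto_norm_int_cofinite {J : Type*} [Fintype J] :
    Tendsto (fun b : J → ℤ => ‖b‖) cofinite atTop := by
  simpa only [cocompact_eq_cofinite] using tendsto_norm_cocompact_atTop (E := J → ℤ)

theorem le_exponent_of_infinite {τ : Nat.Primes → Fin n → ℝ} {y : QS S n} {ω : ℝ}
    (h : {b | ∀ ν i, ‖residual y b ν i‖ ^ (1 / τ ν i) ≤ ‖b‖ ^ (-ω)}.Infinite) :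
    (ω : EReal) ≤ exponent S τ y := by
  let flip : (Fin (n + 1) → ℤ) → Fin (n + 1) → ℤ := fun b => Fin.cons (-b 0) (Fin.tail b)
  have hflip : Function.Involutive flip := fun b => by simp [flip]
  have hnorm : ∀ b, ‖flip b‖ = ‖b‖ := fun b =>
    congrArg NNReal.toReal (Finset.sup_congr rfl fun j _ => by
      cases j using Fin.cases <;> simp [flip, Fin.tail])
  refine le_iSup₂_of_le ω ((h.image hflip.injective.injOn).mono ?_) le_rfl
  rintro _ ⟨b, hb, rfl⟩ ν i
  have hneg : (flip b 0 : ℚ_[(ν.1 : ℕ)]) * y ν i + (flip b i.succ : ℚ_[(ν.1 : ℕ)]) =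
      -residual y b ν i := by
    simp only [flip, Fin.cons_zero, Fin.cons_succ, Fin.tail, residual_apply, Int.cast_neg]
    ring
  rw [hneg, norm_neg, hnorm]
  exact hb ν i

/-- The height of `b` is measured against `X ^ κ` rather than `X` because removing powers of a prime
from a vector of size `X` shrinks it by a factor of that kind. -/
theorem le_exponent_of_frequently {w : Nat.Primes → Fin n → ℝ} (hw : ∀ ν ∈ S, ∀ i, 0 < w ν i)
    {y : QS S n} {s κ ω K C : ℝ} (hs : 0 < s) (hω : 0 ≤ ω) (hκ : κ * ω < s) (hK : 0 < K)
    (hC : 0 < C)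
    (h : ∃ᶠ X : ℝ in atTop, ∃ b ≠ 0, ‖b‖ ≤ K * X ^ κ ∧
      ∀ ν i, ‖residual y b ν i‖ ≤ C * X ^ (-(s * w ν i))) :
    (ω : EReal) ≤ exponent S w y := by
  refine le_exponent_of_infinite (infinite_of_forall_exists_norm_lt (residual y)
    (fun b hb ν i => ?_) fun ε hε => ?_)
  · rw [hb, Pi.zero_apply, Pi.zero_apply, norm_zero,
      Real.zero_rpow (one_div_pos.2 (hw _ ν.2 i)).ne']
    exact Real.rpow_nonneg (norm_nonneg _) _
  have hsmall : ∀ᶠ X : ℝ in atTop, ∀ (ν : S) i, C * X ^ (-(s * w ν i)) < ε :=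
    eventually_all.2 fun ν => eventually_all.2 fun i =>
      eventually_mul_rpow_neg_lt C (mul_pos hs (hw _ ν.2 i)) hε
  have hpow : ∀ᶠ X : ℝ in atTop, ∀ (ν : S) i,
      C ^ (1 / w ν i) * X ^ (-s) < K ^ (-ω) * X ^ (-(κ * ω)) :=
    eventually_all.2 fun ν => eventually_all.2 fun i =>
      eventually_mul_rpow_neg_lt_mul_rpow_neg _ hκ (Real.rpow_pos_of_pos hK (-ω))
  obtain ⟨X, ⟨b, hb0, hbX, hb⟩, hX, hXpow, hXε⟩ :=
    (h.and_eventually ((eventually_gt_atTop 0).and (hpow.and hsmall))).exists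
  have hb_pos : 0 < ‖b‖ := norm_pos_iff.2 hb0
  refine ⟨b, fun ν i => ?_, hb0, ?_⟩
  · have hwi := hw _ ν.2 i
    calc ‖residual y b ν i‖ ^ (1 / w ν i) ≤ (C * X ^ (-(s * w ν i))) ^ (1 / w ν i) := by
          gcongr
          exact hb ν i
      _ = C ^ (1 / w ν i) * X ^ (-s) := by
          rw [Real.mul_rpow hC.le (by positivity), ← Real.rpow_mul hX.le]
          congr 2
          field_simp
      _ ≤ K ^ (-ω) * X ^ (-(κ * ω)) := (hXpow ν i).le
      _ = (K * X ^ κ) ^ (-ω) := by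
          rw [Real.mul_rpow hK.le (by positivity), ← Real.rpow_mul hX.le, mul_neg]
      _ ≤ ‖b‖ ^ (-ω) := Real.rpow_le_rpow_of_nonpos hb_pos hbX (neg_nonpos.2 hω)
  · exact (pi_norm_lt_iff hε).2 fun ν => (pi_norm_lt_iff hε).2 fun i => (hb ν i).trans_lt (hXε ν i)

theorem exists_eq_pow_smul_norm_le {J : Type*} [Fintype J] (p : ℕ) [Fact p.Prime] {b : J → ℤ}
    (hb0 : b ≠ 0) {δ : ℝ} (hδ : ∀ j, ‖(b j : ℚ_[p])‖ ≤ δ) :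
    ∃ (k : ℕ) (b' : J → ℤ), b = (p : ℤ) ^ k • b' ∧ ‖b'‖ ≤ δ * ‖b‖ := by
  obtain ⟨j₀, -⟩ := Function.ne_iff.1 hb0
  have : Nonempty J := ⟨j₀⟩
  obtain ⟨j, hj⟩ := Finite.exists_max fun j => ‖(b j : ℚ_[p])‖
  have hbj : b j ≠ 0 := fun h => hb0 <| funext fun i => by
    simpa [h] using hj i
  have hp0 : (0 : ℝ) < p := by exact_mod_cast (Fact.out : p.Prime).pos
  obtain ⟨k, hk⟩ : ∃ k : ℕ, ‖(b j : ℚ_[p])‖ = (p : ℝ) ^ (-k : ℤ) :=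
    ⟨padicValInt p (b j), by
      rw [Padic.norm_eq_zpow_neg_valuation (Int.cast_ne_zero.2 hbj), Padic.valuation_intCast]⟩
  choose b' hb' using fun i => (Padic.norm_int_le_pow_iff_dvd (b i) k).1 ((hj i).trans_eq hk)
  have hbb' : b = (p : ℤ) ^ k • b' := funext hb'
  refine ⟨k, b', hbb', ?_⟩
  calc ‖b'‖ = (p : ℝ) ^ (-k : ℤ) * ‖b‖ := by
        rw [hbb', norm_smul, norm_pow, Int.norm_natCast, zpow_neg, zpow_natCast,
          inv_mul_cancel_left₀ (by positivity)]
    _ ≤ δ * ‖b‖ := by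
        gcongr
        exact hk ▸ hδ j

theorem norm_residual_forget {ν : Nat.Primes} (y : QS S n) (k : ℕ) (b : Fin (n + 1) → ℤ)
    (σ : S.erase ν) (i : Fin n) :
    ‖residual (forget ν y) b σ i‖ =
      ‖residual y (((ν : ℕ) : ℤ) ^ k • b) ⟨σ, Finset.mem_of_mem_erase σ.2⟩ i‖ := by
  have hunit : ‖((ν : ℕ) : ℚ_[((σ : Nat.Primes) : ℕ)])‖ = 1 :=
    Padic.norm_natCast_eq_one_iff.2 ((Nat.coprime_primes σ.1.2 ν.2).2 fun h =>
      Finset.ne_of_mem_erase σ.2 (Subtype.ext h))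
  rw [map_zsmul, Pi.smul_apply, Pi.smul_apply, zsmul_eq_mul, norm_mul, Int.cast_pow, norm_pow,
    Int.cast_natCast, hunit, one_pow, one_mul]
  rfl

theorem norm_int_le_of_norm_head_le {y : QS S n} {b : Fin (n + 1) → ℤ} {ν : S} {δ : ℝ}
    (hy : ∀ i, ‖y ν i‖ ≤ 1) (h0 : ‖(b 0 : ℚ_[(ν.1 : ℕ)])‖ ≤ δ)
    (hb : ∀ i, ‖residual y b ν i‖ ≤ δ) (j : Fin (n + 1)) : ‖(b j : ℚ_[(ν.1 : ℕ)])‖ ≤ δ := by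
  cases j using Fin.cases with
  | zero => exact h0
  | succ i =>
    have heq : (b i.succ : ℚ_[(ν.1 : ℕ)]) = b 0 * y ν i - residual y b ν i := by
      rw [residual_apply, sub_sub_cancel]
    have hmul : ‖(b 0 : ℚ_[(ν.1 : ℕ)]) * y ν i‖ ≤ δ := by
      rw [norm_mul]
      exact (mul_le_of_le_one_right (norm_nonneg _) (hy i)).trans h0
    rw [heq, sub_eq_add_neg]
    exact (Padic.nonarchimedean _ _).trans (max_le hmul ((norm_neg _).trans_le (hb i)))

/-- If `b 0` were `ν`-adically small then so would be every entry of `b`, and removing the common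
power of `ν` gives a much smaller vector with the same residuals at the other primes. -/
theorem exists_small_of_norm_head_lt {τ : Nat.Primes → Fin n → ℝ} {y : QS S n} (hy : y ∈ ZS S n)
    (ν : S) {μ C : ℝ} (hμ : ∀ i, μ ≤ τ ν i) (hC : 1 ≤ C) {b : Fin (n + 1) → ℤ} (hb1 : 1 ≤ ‖b‖)
    (hb : ∀ σ i, ‖residual y b σ i‖ ≤ C * ‖b‖ ^ (-τ σ i))
    (h0 : ‖(b 0 : ℚ_[(ν.1 : ℕ)])‖ < ‖b‖ ^ (-μ)) :
    ∃ b' ≠ 0, ‖b'‖ ≤ C * ‖b‖ ^ (1 - μ) ∧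
      ∀ σ i, ‖residual (forget ν y) b' σ i‖ ≤ C * ‖b‖ ^ (-τ σ i) := by
  have hb0 : 0 < ‖b‖ := one_pos.trans_le hb1
  have hpow : ∀ i, C * ‖b‖ ^ (-τ ν i) ≤ C * ‖b‖ ^ (-μ) := fun i => by
    gcongr
    exact hμ i
  have hδ := norm_int_le_of_norm_head_le (hy ν)
    (h0.le.trans (le_mul_of_one_le_left (by positivity) hC)) fun i => (hb ν i).trans (hpow i)
  obtain ⟨k, b', hbb', hb'⟩ := exists_eq_pow_smul_norm_le (ν : ℕ) (norm_pos_iff.1 hb0) hδ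
  refine ⟨b', ?_, hb'.trans_eq ?_, fun σ i => ?_⟩
  · rintro rfl
    exact norm_pos_iff.1 hb0 (hbb'.trans (smul_zero _))
  · rw [mul_assoc, ← Real.rpow_add_one hb0.ne', neg_add_eq_sub]
  · rw [norm_residual_forget y k, ← hbb']
    exact hb _ i

/-- The integer vectors which approximate `y` to within a constant of Dirichlet's theorem have a
leading coefficient which is not too small `ν`-adically. -/
def HasLargeHeads (S : Finset Nat.Primes) (τ : Nat.Primes → Fin n → ℝ) (ν : S) (μ : ℝ)
    (y : QS S n) : Prop :=
  ∀ C : ℝ, ∀ᶠ b in cofinite, (∀ σ i, ‖residual y b σ i‖ ≤ C * ‖b‖ ^ (-τ σ i)) →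
    ‖b‖ ^ (-μ) ≤ ‖(b 0 : ℚ_[(ν.1 : ℕ)])‖

theorem hasLargeHeads_of_forall_eventually {τ : Nat.Primes → Fin n → ℝ} {y : QS S n}
    (hy : y ∈ ZS S n) (ν : S) {μ : ℝ} (hμ : ∀ i, μ ≤ τ ν i)
    (h : ∀ C : ℝ, 1 ≤ C → ∀ᶠ X : ℝ in atTop, ¬ ∃ b' ≠ 0, ‖b'‖ ≤ C * X ^ (1 - μ) ∧
      ∀ σ i, ‖residual (forget ν y) b' σ i‖ ≤ C * X ^ (-τ σ i)) :
    HasLargeHeads S τ ν μ y := by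
  intro C
  filter_upwards [tendsto_norm_int_cofinite.eventually (h (max C 1) (le_max_right _ _)),
    tendsto_norm_int_cofinite.eventually_ge_atTop 1] with b hb hb1 hres
  contrapose! hb
  refine exists_small_of_norm_head_lt hy ν hμ (le_max_right _ _) hb1 (fun σ i => ?_) hb
  exact (hres σ i).trans (by gcongr; exact le_max_left _ _)

theorem one_le_norm_int {J : Type*} [Fintype J] {b : J → ℤ} (hb : b ≠ 0) : 1 ≤ ‖b‖ := by
  obtain ⟨j, hj⟩ := Function.ne_iff.1 hb
  refine le_trans ?_ (norm_le_pi_norm b j)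
  rw [Int.norm_eq_abs]
  exact_mod_cast Int.one_le_abs hj

theorem hasLargeHeads_of_one_lt {τ : Nat.Primes → Fin n → ℝ} {y : QS S n} (hy : y ∈ ZS S n)
    (ν : S) {μ : ℝ} (hμ : ∀ i, μ ≤ τ ν i) (hμ1 : 1 < μ) : HasLargeHeads S τ ν μ y := by
  refine hasLargeHeads_of_forall_eventually hy ν hμ fun C _ => ?_
  filter_upwards [eventually_mul_rpow_neg_lt C (sub_pos.2 hμ1) one_pos] with X hX
  rintro ⟨b', hb'0, hb', -⟩
  rw [neg_sub] at hX
  exact (hb'.trans_lt hX).not_ge (one_le_norm_int hb'0)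

theorem hasLargeHeads_of_exponent_lt {τ : Nat.Primes → Fin n → ℝ} {y : QS S n}
    (hy : y ∈ ZS S n) (ν : S) {μ : ℝ} (hμ : ∀ i, μ ≤ τ ν i) (hτ : ∀ σ ∈ S, ∀ i, 0 < τ σ i)
    {s ω : ℝ} (hs : 0 < s) (hω0 : 0 ≤ ω) (hμω : (1 - μ) * ω < s)
    (hω : exponent (S.erase ν) (fun σ i => τ σ i / s) (forget ν y) < ω) :
    HasLargeHeads S τ ν μ y := by
  refine hasLargeHeads_of_forall_eventually hy ν hμ fun C hC => ?_
  by_contra hfreq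
  refine hω.not_ge (le_exponent_of_frequently
    (fun σ hσ i => div_pos (hτ σ (Finset.mem_of_mem_erase hσ) i) hs) hs hω0 hμω
    (one_pos.trans_le hC) (one_pos.trans_le hC) ?_)
  simpa only [Filter.Frequently, mul_div_cancel₀ _ hs.ne'] using hfreq

end Exponents

section Genericity

theorem quasiMeasurePreserving_restrict₂ {ι : Type*} {X : ι → Type*}
    [∀ i, MeasurableSpace (X i)] (μ : ∀ i, Measure (X i)) [∀ i, SigmaFinite (μ i)]
    {s t : Finset ι} (hst : s ⊆ t) :
    Measure.QuasiMeasurePreserving (Finset.restrict₂ (π := X) hst)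
      (Measure.pi fun i : t => μ i) (Measure.pi fun i : s => μ i) := by
  classical
  obtain ⟨u, hsu, rfl⟩ : ∃ u, Disjoint s u ∧ s ∪ u = t :=
    ⟨t \ s, Finset.disjoint_sdiff, Finset.union_sdiff_of_subset hst⟩
  have hpres := measurePreserving_piFinsetUnion hsu μ
  convert Measure.quasiMeasurePreserving_fst.comp (hpres.symm _).quasiMeasurePreserving
  ext x i
  obtain ⟨z, rfl⟩ := (MeasurableEquiv.piFinsetUnion X hsu).surjective x
  rw [Function.comp_apply, MeasurableEquiv.symm_apply_apply]
  exact Equiv.piFinsetUnion_left X hsu i.2 (hst i.2)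

variable {S : Finset Nat.Primes} {n d m : ℕ}

theorem ae_forget (ν : Nat.Primes) {P : QS (S.erase ν) d → Prop}
    (h : ∀ᵐ x ∂haar (S.erase ν) d, P x) : ∀ᵐ x ∂haar S d, P (forget ν x) :=
  (quasiMeasurePreserving_restrict₂
    (fun σ : Nat.Primes => Measure.pi fun _ : Fin d => Measure.addHaarMeasure (unitBall σ))
    (S.erase_subset ν)).ae h

theorem manifoldExponent_empty (U : ∀ ν : Nat.Primes, Set (Fin d → ℚ_[(ν : ℕ)]))
    (f : ∀ ν : Nat.Primes, (Fin d → ℚ_[(ν : ℕ)]) → (Fin m → ℚ_[(ν : ℕ)]))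
    (τ : Nat.Primes → Fin (d + m) → ℝ) : manifoldExponent ∅ U f τ = ⊤ := by
  have hexp (y : QS ∅ (d + m)) : exponent ∅ τ y = ⊤ :=
    EReal.eq_top_iff_forall_lt _ |>.2 fun ω => (EReal.coe_lt_coe_iff.2 (lt_add_one ω)).trans_le
      (le_exponent_of_infinite (by simpa using Set.infinite_univ))
  refine sInf_eq_top.2 fun ω hω => top_le_iff.1 ?_
  have hne : NeZero (haar ∅ d) := ⟨by
    rw [haar, Measure.pi_of_empty _ 0]
    exact Measure.dirac_ne_zero⟩
  obtain ⟨x, hx⟩ := Eventually.exists (Set.mem_ofPred_eq ▸ hω)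
  exact hexp (param ∅ f x) ▸ hx fun ν => absurd ν.2 (Finset.notMem_empty _)

variable {τ : Nat.Primes → Fin n → ℝ} {ν : Nat.Primes}

theorem one_sub_sum_div_pos [NeZero n] (hτ : IsWeight S τ) (hν : ν ∈ S)
    (hne : (S.erase ν).Nonempty) : 0 < 1 - (∑ k, τ ν k) / ((n : ℝ) + 1) := by
  have hothers : 0 < ∑ σ ∈ S.erase ν, ∑ i, τ σ i :=
    Finset.sum_pos (fun σ hσ => Finset.sum_pos
      (fun i _ => hτ.1 σ (Finset.mem_of_mem_erase hσ) i) Finset.univ_nonempty) hne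
  have hsum := hτ.2
  rw [Finset.sum_comm, ← Finset.add_sum_erase S _ hν] at hsum
  rw [sub_pos, div_lt_one (by positivity)]
  linarith

theorem exists_lt_mul_lt_of_lt_exponentBound (hmin : (⨅ i, τ ν i) ≤ 1)
    (hs : 0 < 1 - (∑ k, τ ν k) / ((n : ℝ) + 1)) {e : EReal} (he : e < exponentBound τ ν) :
    ∃ ω : ℝ, 0 ≤ ω ∧ e < ω ∧ (1 - ⨅ i, τ ν i) * ω < 1 - (∑ k, τ ν k) / ((n : ℝ) + 1) := by
  rcases hmin.lt_or_eq with hlt | heq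
  · rw [exponentBound, if_pos hlt] at he
    have hpos : (0 : EReal) < ((1 - (∑ k, τ ν k) / ((n : ℝ) + 1)) / (1 - ⨅ i, τ ν i) : ℝ) :=
      EReal.coe_pos.2 (div_pos hs (sub_pos.2 hlt))
    obtain ⟨ω, heω, hω⟩ := EReal.lt_iff_exists_real_btwn.1 (max_lt he hpos)
    refine ⟨ω, EReal.coe_nonneg.1 ((le_max_right _ _).trans heω.le),
      (le_max_left _ _).trans_lt heω, ?_⟩
    rw [mul_comm]
    exact (lt_div_iff₀ (sub_pos.2 hlt)).1 (EReal.coe_lt_coe_iff.1 hω)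
  · obtain ⟨ω, heω, -⟩ := EReal.lt_iff_exists_real_btwn.1
      (max_lt (he.trans_le le_top) EReal.zero_lt_top)
    refine ⟨ω, EReal.coe_nonneg.1 ((le_max_right _ _).trans heω.le),
      (le_max_left _ _).trans_lt heω, ?_⟩
    rwa [heq, sub_self, zero_mul]

theorem ae_exponent_lt {U : ∀ ν : Nat.Primes, Set (Fin d → ℚ_[(ν : ℕ)])}
    {f : ∀ ν : Nat.Primes, (Fin d → ℚ_[(ν : ℕ)]) → (Fin m → ℚ_[(ν : ℕ)])}
    {τ : Nat.Primes → Fin (d + m) → ℝ} {ω : EReal} (h : manifoldExponent S U f τ < ω) :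
    ∀ᵐ x ∂haar S d, x ∈ domain S U → exponent S τ (param S f x) < ω := by
  obtain ⟨ω', hω', hlt⟩ := sInf_lt_iff.1 h
  filter_upwards [hω'] with x hx hxU using (hx hxU).trans_lt hlt

theorem exists_ae_hasLargeHeads [NeZero (d + m)]
    {U : ∀ ν : Nat.Primes, Set (Fin d → ℚ_[(ν : ℕ)])}
    {f : ∀ ν : Nat.Primes, (Fin d → ℚ_[(ν : ℕ)]) → (Fin m → ℚ_[(ν : ℕ)])}
    {τ : Nat.Primes → Fin (d + m) → ℝ} (hτ : IsWeight S τ) (ν : S)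
    (h : (⨅ i, τ ν i) ≤ 1 → manifoldExponent (S.erase ν) U f (rescale τ ν) < exponentBound τ ν) :
    ∃ μ, (∀ i, μ < τ ν i) ∧ ∀ᵐ x ∂haar S d, x ∈ domain S U →
      param S f x ∈ ZS S (d + m) → HasLargeHeads S τ ν μ (param S f x) := by
  have hlt {μ : ℝ} (hμ : μ < ⨅ i, τ ν i) (i : Fin (d + m)) : μ < τ ν i :=
    hμ.trans_le (ciInf_le (Set.finite_range _).bddBelow i)
  rcases lt_or_ge 1 (⨅ i, τ ν i) with hmin | hmin
  · obtain ⟨μ, hμ1, hμ⟩ := exists_between hmin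
    exact ⟨μ, hlt hμ, .of_forall fun x _ hx =>
      hasLargeHeads_of_one_lt hx ν (fun i => (hlt hμ i).le) hμ1⟩
  have hexp := h hmin
  have hne : (S.erase ν).Nonempty := by
    rw [Finset.nonempty_iff_ne_empty]
    intro hempty
    rw [hempty, manifoldExponent_empty] at hexp
    exact not_top_lt hexp
  have hs := one_sub_sum_div_pos hτ ν.2 hne
  obtain ⟨ω, hω0, heω, hω⟩ := exists_lt_mul_lt_of_lt_exponentBound hmin hs hexp
  obtain ⟨μ, hμω, hμ⟩ : ∃ μ, (1 - μ) * ω < 1 - (∑ k, τ ν k) / (((d + m : ℕ) : ℝ) + 1) ∧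
      μ < ⨅ i, τ ν i := by
    have hcont : Tendsto (fun μ : ℝ => (1 - μ) * ω) (𝓝[<] ⨅ i, τ ν i)
        (𝓝 ((1 - ⨅ i, τ ν i) * ω)) :=
      Continuous.tendsto (by fun_prop) _ |>.mono_left nhdsWithin_le_nhds
    exact ((hcont.eventually_lt_const hω).and self_mem_nhdsWithin).exists
  refine ⟨μ, hlt hμ, ?_⟩
  filter_upwards [ae_forget ν.1 (ae_exponent_lt heω)] with x hx hxU hxZ
  have hexp : exponent (S.erase ν) (rescale τ ν) (forget ν (param S f x)) < ω :=
    hx fun σ => hxU ⟨σ.1, Finset.mem_of_mem_erase σ.2⟩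
  exact hasLargeHeads_of_exponent_lt hxZ ν (fun i => (hlt hμ i).le) hτ.1 hs hω0 hμω hexp

theorem isWeight_rescale (hτ : IsWeight S τ) (hν : ν ∈ S)
    (hs : 0 < 1 - (∑ k, τ ν k) / ((n : ℝ) + 1)) : IsWeight (S.erase ν) (rescale τ ν) := by
  refine ⟨fun σ hσ i => div_pos (hτ.1 σ (Finset.mem_of_mem_erase hσ) i) hs, ?_⟩
  have hsum := hτ.2
  rw [Finset.sum_comm, ← Finset.add_sum_erase S _ hν] at hsum
  simp only [rescale, ← Finset.sum_div]
  rw [Finset.sum_comm, eq_sub_of_add_eq' hsum, div_eq_iff hs.ne']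
  field_simp

theorem one_lt_sum_rescale (hτ : IsWeight S τ)
    (hτ_dist : ∀ ν ∈ S, ∀ j, (∑ i, τ ν i) / ((n : ℝ) + 1) < τ ν j) (hν : ν ∈ S)
    (hs : 0 < 1 - (∑ k, τ ν k) / ((n : ℝ) + 1)) (i : Fin n) :
    1 < ∑ σ ∈ S.erase ν, rescale τ ν σ i := by
  have hsum : ∑ σ ∈ S.erase ν, (∑ i, τ σ i) / ((n : ℝ) + 1) =
      1 - (∑ k, τ ν k) / ((n : ℝ) + 1) := by
    have hnorm := hτ.2
    rw [Finset.sum_comm, ← Finset.add_sum_erase S _ hν] at hnorm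
    rw [← Finset.sum_div, eq_sub_of_add_eq' hnorm]
    field_simp
  simp only [rescale, ← Finset.sum_div]
  rw [one_lt_div hs, ← hsum]
  refine Finset.sum_lt_sum_of_nonempty ?_ fun σ hσ =>
    hτ_dist σ (Finset.mem_of_mem_erase hσ) i
  rw [← hsum] at hs
  exact Finset.nonempty_of_sum_ne_zero hs.ne'

theorem StronglyExtremal.manifoldExponent_lt [NeZero (d + m)]
    {U : ∀ ν : Nat.Primes, Set (Fin d → ℚ_[(ν : ℕ)])}
    {f : ∀ ν : Nat.Primes, (Fin d → ℚ_[(ν : ℕ)]) → (Fin m → ℚ_[(ν : ℕ)])}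
    {τ : Nat.Primes → Fin (d + m) → ℝ} (hτ : IsWeight S τ)
    (hτ_dist : ∀ ν ∈ S, ∀ j, (∑ i, τ ν i) / (((d + m : ℕ) : ℝ) + 1) < τ ν j) (hν : ν ∈ S)
    (hmin : (⨅ i, τ ν i) ≤ 1) (h : StronglyExtremal (S.erase ν) U f) :
    manifoldExponent (S.erase ν) U f (rescale τ ν) < exponentBound τ ν := by
  have hlt : (∑ k, τ ν k) / (((d + m : ℕ) : ℝ) + 1) < ⨅ i, τ ν i := by
    obtain ⟨i, hi⟩ := exists_eq_ciInf_of_finite (f := fun i => τ ν i)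
    exact hi ▸ hτ_dist ν hν i
  have hs := sub_pos.2 (hlt.trans_le hmin)
  rw [h _ (isWeight_rescale hτ hν hs) (one_lt_sum_rescale hτ hτ_dist hν hs), exponentBound]
  split_ifs with hmin1
  · rw [← EReal.coe_one, EReal.coe_lt_coe_iff, one_lt_div (sub_pos.2 hmin1)]
    linarith
  · exact EReal.coe_lt_top 1

end Genericity

section Taylor

variable {K : Type*} [NontriviallyNormedField K] {E F : Type*}
  [NormedAddCommGroup E] [NormedSpace K E] [NormedAddCommGroup F] [NormedSpace K F]

variable (K) in
/-- `f` has a first order Taylor expansion at `x` with a quadratic remainder. -/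
def HasQuadraticApproxAt (f : E → F) (x : E) : Prop :=
  ∃ D : E →L[K] F, (fun y => f y - f x - D (y - x)) =O[𝓝 x] fun y => ‖y - x‖ ^ 2

variable {f : E → F} {U : Set E} {g : E × E × K → F} {x : E}

theorem mem_diffQuotDomain_zero (hx : x ∈ U) (v : E) : (x, v, (0 : K)) ∈ diffQuotDomain K U :=
  ⟨hx, by simpa using hx⟩

theorem isOpen_diffQuotDomain (hU : IsOpen U) : IsOpen (diffQuotDomain K U) :=
  (hU.preimage continuous_fst).inter
    (hU.preimage (f := fun z : E × E × K => z.1 + z.2.2 • z.2.1) (by fun_prop))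

theorem IsDiffQuot.continuousAt (hg : IsDiffQuot K f U g) (hU : IsOpen U) {z : E × E × K}
    (hz : z ∈ diffQuotDomain K U) : ContinuousAt g z :=
  hg.1.continuousAt ((isOpen_diffQuotDomain hU).mem_nhds hz)

theorem IsDiffQuot.tendsto (hg : IsDiffQuot K f U g) (hU : IsOpen U) (hx : x ∈ U) (v : E)
    {φ : K → E × E × K} (hφ : ContinuousAt φ 0) (h0 : φ 0 = (x, v, 0)) :
    (∀ᶠ t in 𝓝[≠] (0 : K), φ t ∈ diffQuotDomain K U) ∧
      Tendsto (fun t => g (φ t)) (𝓝[≠] 0) (𝓝 (g (x, v, 0))) := by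
  have hmem := mem_diffQuotDomain_zero (K := K) hx v
  have hφ' : Tendsto φ (𝓝[≠] 0) (𝓝 (x, v, 0)) :=
    h0 ▸ hφ.tendsto.mono_left nhdsWithin_le_nhds
  exact ⟨hφ' ((isOpen_diffQuotDomain hU).mem_nhds hmem),
    (hg.continuousAt hU hmem).tendsto.comp hφ'⟩

theorem IsDiffQuot.map_smul (hg : IsDiffQuot K f U g) (hU : IsOpen U) (hx : x ∈ U)
    (a : K) (v : E) : g (x, a • v, 0) = a • g (x, v, 0) := by
  obtain ⟨hmem, hlim⟩ :=
    hg.tendsto hU hx (a • v) (φ := fun t => (x, a • v, t)) (by fun_prop) rfl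
  obtain ⟨hmem', hlim'⟩ :=
    hg.tendsto hU hx v (φ := fun t => (x, v, t * a)) (by fun_prop) (by simp)
  refine tendsto_nhds_unique hlim ((hlim'.const_smul a).congr' ?_)
  filter_upwards [hmem, hmem', self_mem_nhdsWithin] with t ht ht' ht0
  refine smul_right_injective F ht0 ?_
  change t • a • g (x, v, t * a) = t • g (x, a • v, t)
  rw [← hg.2 _ _ _ ht, smul_smul, ← hg.2 _ _ _ ht', mul_smul]

theorem IsDiffQuot.map_add (hg : IsDiffQuot K f U g) (hU : IsOpen U) (hx : x ∈ U)
    (v w : E) : g (x, v + w, 0) = g (x, v, 0) + g (x, w, 0) := by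
  obtain ⟨hmem, hlim⟩ :=
    hg.tendsto hU hx (v + w) (φ := fun t => (x, v + w, t)) (by fun_prop) rfl
  obtain ⟨hmemv, hlimv⟩ := hg.tendsto hU hx v (φ := fun t => (x, v, t)) (by fun_prop) rfl
  obtain ⟨hmemw, hlimw⟩ :=
    hg.tendsto hU hx w (φ := fun t => (x + t • v, w, t)) (by fun_prop) (by simp)
  refine tendsto_nhds_unique hlim ((hlimv.add hlimw).congr' ?_)
  filter_upwards [hmem, hmemv, hmemw, self_mem_nhdsWithin] with t ht htv htw ht0
  refine smul_right_injective F ht0 ?_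
  change t • (g (x, v, t) + g (x + t • v, w, t)) = t • g (x, v + w, t)
  rw [smul_add, ← hg.2 _ _ _ ht, ← hg.2 _ _ _ htv, ← hg.2 _ _ _ htw, smul_add, add_assoc,
    add_comm, sub_add_sub_cancel]

/-- The derivative read off from an extended difference quotient. -/
def IsDiffQuot.fderiv (hg : IsDiffQuot K f U g) (hU : IsOpen U) (hx : x ∈ U) : E →L[K] F where
  toFun v := g (x, v, 0)
  map_add' := hg.map_add hU hx
  map_smul' := hg.map_smul hU hx
  cont := continuous_iff_continuousAt.2 fun v =>
    (hg.continuousAt hU (mem_diffQuotDomain_zero hx v)).comp (f := fun v => (x, v, (0 : K)))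
      (by fun_prop)

theorem IsDiffQuot.sub_sub_eq_smul_smul (hg : IsDiffQuot K f U g) (hU : IsOpen U) (hx : x ∈ U)
    {h : (E × E × K) × (E × E × K) × K → F} (hh : IsDiffQuot K g (diffQuotDomain K U) h)
    {v : E} {t : K} (hv : x + t • v ∈ U) :
    f (x + t • v) - f x - g (x, t • v, 0) = t • t • h ((x, v, 0), (0, 0, 1), t) := by
  have hvt : (x, v, t) ∈ diffQuotDomain K U := ⟨hx, hv⟩
  have hquot := hh.2 (x, v, 0) (0, 0, 1) t ⟨mem_diffQuotDomain_zero hx v, by simpa using hvt⟩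
  have hshift : (x, v, (0 : K)) + t • (0, 0, 1) = (x, v, t) := by simp
  rw [hg.map_smul hU hx, hg.2 x v t hvt, ← smul_sub, ← hquot, hshift]

theorem IsC2On.hasQuadraticApproxAt (hf : IsC2On K f U) (hU : IsOpen U) (hx : x ∈ U) :
    HasQuadraticApproxAt K f x := by
  obtain ⟨g, hg, h, hh⟩ := hf
  refine ⟨hg.fderiv hU hx, ?_⟩
  obtain ⟨M, hM⟩ : ∃ M, ∀ᶠ p : E × K in 𝓝 0, ‖h ((x, p.1, 0), (0, 0, 1), p.2)‖ < M :=
    ⟨_, ((hh.continuousAt (isOpen_diffQuotDomain hU)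
      (mem_diffQuotDomain_zero (mem_diffQuotDomain_zero hx 0) _)).comp
        (f := fun p : E × K => ((x, p.1, (0 : K)), ((0 : E), (0 : E), (1 : K)), p.2))
        (x := 0) (by fun_prop)).norm.eventually_lt_const (lt_add_one _)⟩
  obtain ⟨δ, hδ, hball⟩ := Metric.eventually_nhds_iff.1 hM
  obtain ⟨c, hc⟩ := NormedField.exists_one_lt_norm K
  have hnear : ∀ᶠ y in 𝓝 x, δ⁻¹ * ‖c‖ * ‖y - x‖ < δ :=
    ContinuousAt.eventually_lt (by fun_prop) continuousAt_const (by simpa using hδ)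
  refine Asymptotics.IsBigO.of_bound (M * (δ⁻¹ * ‖c‖) ^ 2) ?_
  filter_upwards [hU.eventually_mem hx, hnear] with y hyU hyδ
  rcases eq_or_ne y x with rfl | hne
  · simp
  -- write `y - x = a⁻¹ • v` with `v` of size about `δ`
  obtain ⟨a, ha, hlt, -, hinv⟩ := rescale_to_shell hc hδ (sub_ne_zero.2 hne)
  have hy : x + a⁻¹ • a • (y - x) = y := by rw [inv_smul_smul₀ ha, add_sub_cancel]
  have herr := hg.sub_sub_eq_smul_smul hU hx hh (hy ▸ hyU)
  rw [hy, inv_smul_smul₀ ha] at herr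
  have hbound := hball (y := (a • (y - x), a⁻¹)) (by
    rw [dist_zero_right, Prod.norm_def, norm_inv]
    exact max_lt hlt (hinv.trans_lt hyδ))
  calc ‖f y - f x - g (x, y - x, 0)‖
      = ‖a‖⁻¹ ^ 2 * ‖h ((x, a • (y - x), 0), (0, 0, 1), a⁻¹)‖ := by
        rw [herr, norm_smul, norm_smul, norm_inv, sq, mul_assoc]
    _ ≤ (δ⁻¹ * ‖c‖ * ‖y - x‖) ^ 2 * M := by gcongr
    _ = M * (δ⁻¹ * ‖c‖) ^ 2 * ‖‖y - x‖ ^ 2‖ := by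
        rw [norm_pow, norm_norm]
        ring

theorem HasQuadraticApproxAt.exists_eventually (hf : HasQuadraticApproxAt K f x) :
    ∃ D : E →ₗ[K] F, ∀ᶠ M : ℝ in atTop, (∀ v, ‖D v‖ ≤ M * ‖v‖) ∧
      ∀ᶠ y in 𝓝 x, ‖f y - f x - D (y - x)‖ ≤ M * ‖y - x‖ ^ 2 := by
  obtain ⟨D, hD⟩ := hf
  obtain ⟨M₀, hM₀⟩ := hD.bound
  refine ⟨D, ?_⟩
  filter_upwards [eventually_ge_atTop ‖D‖, eventually_ge_atTop M₀] with M hDM hM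
  refine ⟨D.le_of_opNorm_le hDM, ?_⟩
  filter_upwards [hM₀] with y hy
  rw [norm_pow, norm_norm] at hy
  exact hy.trans (by gcongr)

variable [IsUltrametricDist E] [IsUltrametricDist F]

theorem norm_smul_sub_le_of_norm_smul_sub_le {β : K} {y a : E} {C : ℝ}
    (hx : ‖β • x - a‖ ≤ C) (hy : ‖β • y - a‖ ≤ C) : ‖β‖ * ‖y - x‖ ≤ C := by
  rw [← dist_eq_norm] at hx hy
  rw [← norm_smul, smul_sub, ← dist_eq_norm]
  exact (dist_triangle_max _ a _).trans (max_le hy (dist_comm a _ ▸ hx))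

/-- Along the tangent directions the form `β • f - a'` is controlled by its values at `x`; the
quadratic remainder is negligible because `y` is within `C * θ / ‖β‖` of `x`. -/
theorem norm_smul_apply_sub_lt {D : E →ₗ[K] F} {y a : E} {a' : F} {β : K} {M C η ε θ κ : ℝ}
    (hβ : β ≠ 0) (hM : 0 ≤ M) (hD : ∀ v, ‖D v‖ ≤ M * ‖v‖)
    (hf : ‖f y - f x - D (y - x)‖ ≤ M * ‖y - x‖ ^ 2) (hηC : η ≤ C) (hηε : η < ε)
    (hMη : M * η < ε) (hθ : 0 ≤ θ) (hκ : 0 < κ) (hθκ : θ ≤ κ) (hθβ : M * C ^ 2 * θ < ε * ‖β‖)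
    (hx : ‖β • x - a‖ ≤ C * θ) (hy : ‖β • y - a‖ ≤ η * θ) (hη : 0 ≤ η)
    (hfx : ‖β • f x - a' - D (β • x - a)‖ ≤ η * κ) : ‖β • f y - a'‖ < ε * κ := by
  have hdecomp : β • f y - a' = β • f x - a' - D (β • x - a) + D (β • y - a) +
      β • (f y - f x - D (y - x)) := by
    simp only [map_sub, map_smul, smul_sub]
    abel
  have hlin : ‖D (β • y - a)‖ < ε * κ := calc
    ‖D (β • y - a)‖ ≤ M * (η * κ) := (hD _).trans (by gcongr; exact hy.trans (by gcongr))
    _ = M * η * κ := (mul_assoc _ _ _).symm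
    _ < ε * κ := by gcongr
  have hquad : ‖β • (f y - f x - D (y - x))‖ < ε * κ := by
    have hβ0 := norm_pos_iff.2 hβ
    have hdist : ‖β‖ * ‖y - x‖ ≤ C * θ :=
      norm_smul_sub_le_of_norm_smul_sub_le hx (hy.trans (by gcongr))
    refine lt_of_mul_lt_mul_left (a := ‖β‖) ?_ hβ0.le
    calc ‖β‖ * ‖β • (f y - f x - D (y - x))‖ ≤ ‖β‖ * (‖β‖ * (M * ‖y - x‖ ^ 2)) := by
          rw [norm_smul]
          gcongr
      _ = M * (‖β‖ * ‖y - x‖) ^ 2 := by ring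
      _ ≤ M * (C * θ) ^ 2 := by gcongr
      _ = M * C ^ 2 * θ * θ := by ring
      _ ≤ M * C ^ 2 * θ * κ := by gcongr
      _ < ε * ‖β‖ * κ := by gcongr
      _ = ‖β‖ * (ε * κ) := by ring
  rw [hdecomp]
  exact (IsUltrametricDist.norm_add_le_max _ _).trans_lt (max_lt
    ((IsUltrametricDist.norm_add_le_max _ _).trans_lt
      (max_lt (hfx.trans_lt (by gcongr)) hlin)) hquad)

theorem eventually_norm_smul_apply_sub_lt {D : E →ₗ[K] F} {M C η ε μ ρ τ : ℝ} (hM : 0 ≤ M)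
    (hD : ∀ v, ‖D v‖ ≤ M * ‖v‖) (hf : ∀ᶠ y in 𝓝 x, ‖f y - f x - D (y - x)‖ ≤ M * ‖y - x‖ ^ 2)
    (hη : 0 < η) (hηC : η ≤ C) (hηε : η < ε) (hMη : M * η < ε) (hμρ : μ < ρ) (hτρ : τ ≤ ρ) :
    ∀ᶠ X : ℝ in atTop, ∀ (β : K) (a : E) (a' : F), X ^ (-μ) ≤ ‖β‖ → ‖β • x - a‖ ≤ C * X ^ (-ρ) →
      ‖β • f x - a' - D (β • x - a)‖ ≤ η * X ^ (-τ) → ∀ y, ‖β • y - a‖ ≤ η * X ^ (-ρ) →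
      ‖β • f y - a'‖ < ε * X ^ (-τ) := by
  obtain ⟨δ, hδ, hball⟩ := Metric.eventually_nhds_iff.1 hf
  filter_upwards [eventually_mul_rpow_neg_lt_mul_rpow_neg C hμρ hδ,
    eventually_mul_rpow_neg_lt_mul_rpow_neg (M * C ^ 2) hμρ (hη.trans hηε), eventually_ge_atTop 1]
    with X hXδ hXε hX1 β a a' hβ hx hfx y hy
  have hX0 : 0 < X := one_pos.trans_le hX1
  have hε : 0 < ε := hη.trans hηε
  have hβ0 : 0 < ‖β‖ := (Real.rpow_pos_of_pos hX0 _).trans_le hβ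
  have hdist : dist y x < δ := by
    refine lt_of_mul_lt_mul_left (a := ‖β‖) ?_ hβ0.le
    calc ‖β‖ * dist y x ≤ C * X ^ (-ρ) := by
          rw [dist_eq_norm]
          exact norm_smul_sub_le_of_norm_smul_sub_le hx (hy.trans (by gcongr))
      _ < δ * X ^ (-μ) := hXδ
      _ ≤ δ * ‖β‖ := by gcongr
      _ = ‖β‖ * δ := mul_comm _ _
  exact norm_smul_apply_sub_lt (norm_pos_iff.1 hβ0) hM hD (hball hdist) hηC hηε hMη
    (by positivity) (by positivity) (by gcongr) (hXε.trans_le (by gcongr)) hx hy hη.le hfx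

end Taylor

section Boxes

variable {S : Finset Nat.Primes} {d m : ℕ} {τ : Nat.Primes → Fin (d + m) → ℝ}
  {f : ∀ ν : Nat.Primes, (Fin d → ℚ_[(ν : ℕ)]) → (Fin m → ℚ_[(ν : ℕ)])}

theorem residual_param_castAdd (x : QS S d) (b : Fin (d + m + 1) → ℤ) (ν : S) (i : Fin d) :
    residual (param S f x) b ν (i.castAdd m) = b 0 * x ν i - b (i.castAdd m).succ := by
  rw [residual_apply, param, Fin.append_left]

theorem residual_param_natAdd (x : QS S d) (b : Fin (d + m + 1) → ℤ) (ν : S) (j : Fin m) :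
    residual (param S f x) b ν (j.natAdd d) = b 0 * f ν (x ν) j - b (j.natAdd d).succ := by
  rw [residual_apply, param, Fin.append_right]

/-- The points of `ℚ_S^d` at which the first `d` inequalities defining `W` hold for `b`, with
constant `c`. -/
def baseBox (S : Finset Nat.Primes) (τ : Nat.Primes → Fin (d + m) → ℝ)
    (b : Fin (d + m + 1) → ℤ) (c : ℝ) : Set (QS S d) :=
  {x | ∀ ν i, ‖(b 0 : ℚ_[(ν.1 : ℕ)]) * x ν i - b (i.castAdd m).succ‖ ≤
    c * ‖b‖ ^ (-τ ν (i.castAdd m))}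

/-- All inequalities defining `W` hold for `b`, with constant `ε`, on the part of the manifold over
the box with constant `η`. -/
def ControlsBox (S : Finset Nat.Primes)
    (f : ∀ ν : Nat.Primes, (Fin d → ℚ_[(ν : ℕ)]) → (Fin m → ℚ_[(ν : ℕ)]))
    (τ : Nat.Primes → Fin (d + m) → ℝ) (ε η : ℝ) (b : Fin (d + m + 1) → ℤ) : Prop :=
  ∀ x ∈ baseBox S τ b η, ∀ ν i, ‖residual (param S f x) b ν i‖ < ε * ‖b‖ ^ (-τ ν i)

/-- The integer vectors `b` for which `b 0` is not too small at any prime of `S`. -/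
def largeHeads (S : Finset Nat.Primes) (n : ℕ) (μ : S → ℝ) : Set (Fin (n + 1) → ℤ) :=
  {b | b ≠ 0 ∧ ∀ ν : S, ‖b‖ ^ (-μ ν) ≤ ‖(b 0 : ℚ_[(ν.1 : ℕ)])‖}

theorem head_pos_of_mem_largeHeads {n : ℕ} {μ : S → ℝ} {b : Fin (n + 1) → ℤ}
    (hb : b ∈ largeHeads S n μ) (ν : S) : 0 < ‖(b 0 : ℚ_[(ν.1 : ℕ)])‖ :=
  (Real.rpow_pos_of_pos (norm_pos_iff.2 hb.1) _).trans_le (hb.2 ν)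

theorem baseBox_eq_pi_closedBall {μ : S → ℝ} {b : Fin (d + m + 1) → ℤ}
    (hb : b ∈ largeHeads S (d + m) μ) (c : ℝ) :
    baseBox S τ b c = Set.univ.pi fun ν : S => Set.univ.pi fun i : Fin d =>
      closedBall ((b (i.castAdd m).succ / b 0 : ℚ_[(ν.1 : ℕ)]))
        (c * (‖b‖ ^ (-τ ν (i.castAdd m)) / ‖(b 0 : ℚ_[(ν.1 : ℕ)])‖)) := by
  ext x
  simp only [baseBox, Set.mem_ofPred_eq, Set.mem_univ_pi, mem_closedBall]
  refine forall₂_congr fun ν i => ?_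
  have hb0 := head_pos_of_mem_largeHeads hb ν
  rw [← mul_div_assoc, le_div_iff₀' hb0, dist_eq_norm, ← norm_mul, mul_sub,
    mul_div_cancel₀ _ (norm_pos_iff.1 hb0)]

theorem tendsto_radius_largeHeads {n : ℕ} {μ : S → ℝ} (ν : S) {t : ℝ} (ht : μ ν < t) :
    Tendsto (fun b : largeHeads S n μ => ‖b.1‖ ^ (-t) / ‖(b.1 0 : ℚ_[(ν.1 : ℕ)])‖)
      cofinite (𝓝 0) := by
  have hlim : Tendsto (fun b : largeHeads S n μ => ‖b.1‖ ^ (-(t - μ ν))) cofinite (𝓝 0) :=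
    (tendsto_rpow_neg_atTop (sub_pos.2 ht)).comp
      (tendsto_norm_int_cofinite.comp Subtype.val_injective.tendsto_cofinite)
  refine squeeze_zero (fun b => by positivity) (fun b => ?_) hlim
  have hb := norm_pos_iff.2 b.2.1
  rw [div_le_iff₀ (head_pos_of_mem_largeHeads b.2 ν)]
  calc ‖b.1‖ ^ (-t) = ‖b.1‖ ^ (-(t - μ ν)) * ‖b.1‖ ^ (-μ ν) := by
        rw [← Real.rpow_add hb]
        ring_nf
    _ ≤ _ := by
        gcongr
        exact b.2.2 ν

theorem shrinksAE_baseBox {μ : S → ℝ} (hμ : ∀ ν i, μ ν < τ ν i) {C η : ℝ} (hC : 0 < C)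
    (hη : 0 < η) :
    ShrinksAE (haar S d) (fun b : largeHeads S (d + m) μ => baseBox S τ b.1 C)
      (fun b => baseBox S τ b.1 η) := by
  have h := shrinksAE_haar
    (w := fun (b : largeHeads S (d + m) μ) ν i => (b.1 (i.castAdd m).succ / b.1 0))
    (r := fun b ν i => η * (‖b.1‖ ^ (-τ ν (i.castAdd m)) / ‖(b.1 0 : ℚ_[(ν.1 : ℕ)])‖))
    (fun ν i => by
      simpa only [mul_zero] using (tendsto_radius_largeHeads ν (hμ ν (i.castAdd m))).const_mul η)
    (fun b ν i => by positivity) (div_pos hC hη)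
  simp_rw [← mul_assoc, div_mul_cancel₀ C hη.ne'] at h
  have hbox : ∀ c, (fun b : largeHeads S (d + m) μ => baseBox S τ b.1 c) = fun b => _ := fun c =>
    funext fun b => baseBox_eq_pi_closedBall b.2 c
  rw [hbox C, hbox η]
  exact h

theorem ae_infinite_largeHeads {μ : S → ℝ} (hμ : ∀ ν i, μ ν < τ ν i) {C η : ℝ} (hC : 0 < C)
    (hη : 0 < η) (P : Set (Fin (d + m + 1) → ℤ)) :
    ∀ᵐ x ∂haar S d, {b ∈ largeHeads S (d + m) μ ∩ P | x ∈ baseBox S τ b C}.Infinite →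
      {b ∈ P | x ∈ baseBox S τ b η}.Infinite := by
  filter_upwards [shrinksAE_baseBox hμ hC hη (Subtype.val ⁻¹' P)] with x hx hinf
  refine ((hx ?_).image Subtype.val_injective.injOn).mono ?_
  · refine (hinf.preimage (f := Subtype.val) fun b hb => ⟨⟨b, hb.1.1⟩, rfl⟩).mono fun b hb => ?_
    exact ⟨hb.1.2, hb.2⟩
  · rintro _ ⟨b, hb, rfl⟩
    exact hb

end Boxes

section Shear

variable {S : Finset Nat.Primes} {d m : ℕ} {τ : Nat.Primes → Fin (d + m) → ℝ}
  {D : ∀ ν : S, (Fin d → ℚ_[(ν.1 : ℕ)]) →ₗ[ℚ_[(ν.1 : ℕ)]] (Fin m → ℚ_[(ν.1 : ℕ)])}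

/-- The unipotent map `(u, v) ↦ (u, v - D u)` of `ℚ_S^{d+m}`, which straightens the graph of `D`. -/
def shear (D : ∀ ν : S, (Fin d → ℚ_[(ν.1 : ℕ)]) →ₗ[ℚ_[(ν.1 : ℕ)]] (Fin m → ℚ_[(ν.1 : ℕ)])) :
    QS S (d + m) →+ QS S (d + m) :=
  AddMonoidHom.mk' (fun y ν => Fin.append (fun i => y ν (i.castAdd m))
      fun j => y ν (j.natAdd d) - D ν (fun i => y ν (i.castAdd m)) j) fun y y' => by
    ext ν i
    cases i using Fin.addCases with
    | left i => simp only [Pi.add_apply, Fin.append_left]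
    | right j =>
      have hadd := congrFun (map_add (D ν) (fun i => y ν (i.castAdd m))
        fun i => y' ν (i.castAdd m)) j
      simp only [Pi.add_def] at hadd
      simp only [Pi.add_apply, Fin.append_right, hadd]
      ring

theorem shear_castAdd (y : QS S (d + m)) (ν : S) (i : Fin d) :
    shear D y ν (i.castAdd m) = y ν (i.castAdd m) := by
  simp only [shear, AddMonoidHom.mk'_apply, Fin.append_left]

theorem shear_natAdd (y : QS S (d + m)) (ν : S) (j : Fin m) :
    shear D y ν (j.natAdd d) = y ν (j.natAdd d) - D ν (fun i => y ν (i.castAdd m)) j := by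
  simp only [shear, AddMonoidHom.mk'_apply, Fin.append_right]

theorem norm_le_of_norm_shear_le {M C η X : ℝ} (hM : 1 ≤ M) (hηC : η ≤ C) (hX : 1 ≤ X) (hC : 0 ≤ C)
    (hD : ∀ ν v, ‖D ν v‖ ≤ M * ‖v‖)
    (hτ : ∀ ν ∈ S, ∀ (i : Fin d) (j : Fin m), τ ν (j.natAdd d) ≤ τ ν (i.castAdd m))
    {y : QS S (d + m)} (hy : ∀ ν i, ‖shear D y ν i‖ ≤
      Fin.append (fun _ : Fin d => C) (fun _ : Fin m => η) i * X ^ (-τ ν i)) (ν : S)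
    (i : Fin (d + m)) : ‖y ν i‖ ≤ M * C * X ^ (-τ ν i) := by
  have hC_le : C ≤ M * C := le_mul_of_one_le_left hC hM
  have hhead (i : Fin d) : ‖y ν (i.castAdd m)‖ ≤ C * X ^ (-τ ν (i.castAdd m)) := by
    simpa only [shear_castAdd, Fin.append_left] using hy ν (i.castAdd m)
  cases i using Fin.addCases with
  | left i => exact (hhead i).trans (by gcongr)
  | right j =>
    have htail := hy ν (j.natAdd d)
    rw [shear_natAdd, Fin.append_right] at htail
    have hDy : ‖D ν (fun i => y ν (i.castAdd m)) j‖ ≤ M * C * X ^ (-τ ν (j.natAdd d)) := by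
      refine (norm_le_pi_norm _ j).trans ((hD ν _).trans ?_)
      rw [mul_assoc]
      gcongr
      exact (pi_norm_le_iff_of_nonneg (by positivity)).2 fun i => (hhead i).trans (by
        gcongr
        exact hτ ν ν.2 i j)
    rw [← sub_add_cancel (y ν (j.natAdd d)) (D ν (fun i => y ν (i.castAdd m)) j)]
    exact (Padic.nonarchimedean _ _).trans (max_le (htail.trans (by gcongr; linarith)) hDy)

end Shear

section Approximation

variable {S : Finset Nat.Primes} {d m : ℕ} {τ : Nat.Primes → Fin (d + m) → ℝ}
  {f : ∀ ν : Nat.Primes, (Fin d → ℚ_[(ν : ℕ)]) → (Fin m → ℚ_[(ν : ℕ)])}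

theorem IsWeight.nonempty {n : ℕ} {τ : Nat.Primes → Fin n → ℝ} (hτ : IsWeight S τ) :
    S.Nonempty := by
  rw [Finset.nonempty_iff_ne_empty]
  rintro rfl
  have hsum := hτ.2
  simp only [Finset.sum_empty, Finset.sum_const_zero] at hsum
  exact (Nat.cast_add_one_pos n).ne hsum

theorem exists_infinite_norm_le_append (hd : d ≠ 0) (hτ : IsWeight S τ)
    (L : (Fin (d + m + 1) → ℤ) →+ QS S (d + m)) {η : ℝ} (hη : 0 < η) :
    ∃ C : ℕ, 1 ≤ C ∧ {b | ∀ ν i, ‖L b ν i‖ ≤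
      Fin.append (fun _ : Fin d => (C : ℝ)) (fun _ : Fin m => η) i *
        ‖b‖ ^ (-τ ν i)}.Infinite := by
  have hS : Nonempty S := hτ.nonempty.to_subtype
  obtain ⟨B, hB⟩ := infinite_setOf_norm_padic_le (ι := S × Fin (d + m)) (p := fun k => (k.1.1 : ℕ))
    (τ := fun k => τ k.1 k.2)
    (fun k => (Pi.evalAddMonoidHom _ k.2).comp ((Pi.evalAddMonoidHom _ k.1).comp L))
    (fun k => hτ.1 _ k.1.2 _) (by
      rw [Fintype.sum_prod_type_right, Fintype.card_fin, Nat.cast_add_one, ← hτ.2]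
      exact Finset.sum_le_sum fun i _ => (Finset.sum_coe_sort S fun ν => τ ν i).le)
  have hprod (C : ℝ) : ∏ k : S × Fin (d + m), Fin.append (fun _ : Fin d => C) (fun _ => η) k.2 =
      (C ^ d * η ^ m) ^ Fintype.card S := by
    simp [Fintype.prod_prod_type, Fin.prod_univ_add]
  have hlim : Tendsto (fun C : ℕ => ((C : ℝ) ^ d * η ^ m) ^ Fintype.card S) atTop atTop :=
    (tendsto_pow_atTop Fintype.card_ne_zero).comp (((tendsto_pow_atTop hd).comp
      tendsto_natCast_atTop_atTop).atTop_mul_const (by positivity))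
  obtain ⟨C, hCB, hC⟩ := ((hlim.eventually_gt_atTop B).and (eventually_ge_atTop 1)).exists
  refine ⟨C, hC, (hB (fun k => Fin.append (fun _ : Fin d => (C : ℝ)) (fun _ => η) k.2)
    (fun k => ?_) (hprod C ▸ hCB)).mono fun b (hb : ∀ k, _) ν i => hb (ν, i)⟩
  have hC0 : (0 : ℝ) < C := Nat.cast_pos.2 hC
  cases k.2 using Fin.addCases with
  | left i => simpa only [Fin.append_left] using hC0
  | right j => simpa only [Fin.append_right] using hη

theorem eventually_controlsBox (hd : d ≠ 0) {μ : S → ℝ} (hμ : ∀ ν i, μ ν < τ ν i)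
    (hτ : ∀ ν ∈ S, ∀ (i : Fin d) (j : Fin m), τ ν (j.natAdd d) ≤ τ ν (i.castAdd m))
    {D : ∀ ν : S, (Fin d → ℚ_[(ν.1 : ℕ)]) →ₗ[ℚ_[(ν.1 : ℕ)]] (Fin m → ℚ_[(ν.1 : ℕ)])}
    {x : QS S d} {M C η ε : ℝ} (hM : 0 ≤ M) (hD : ∀ ν v, ‖D ν v‖ ≤ M * ‖v‖)
    (hf : ∀ ν : S, ∀ᶠ v in 𝓝 (x ν), ‖f ν v - f ν (x ν) - D ν (v - x ν)‖ ≤ M * ‖v - x ν‖ ^ 2)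
    (hη : 0 < η) (hηC : η ≤ C) (hηε : η < ε) (hMη : M * η < ε) :
    ∀ᶠ b in cofinite, b ∈ largeHeads S (d + m) μ →
      (∀ ν i, ‖shear D (residual (param S f x) b) ν i‖ ≤
        Fin.append (fun _ : Fin d => C) (fun _ : Fin m => η) i * ‖b‖ ^ (-τ ν i)) →
      ControlsBox S f τ ε η b := by
  have : NeZero d := ⟨hd⟩
  choose i₀ hi₀ using fun ν : S => Finite.exists_min fun i : Fin d => τ ν (i.castAdd m)
  have htaylor (ν : S) (j : Fin m) := tendsto_norm_int_cofinite (J := Fin (d + m + 1)) |>.eventually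
    (eventually_norm_smul_apply_sub_lt (D := (LinearMap.proj j).comp (D ν))
      (f := fun v => f ν v j) hM (fun v => (norm_le_pi_norm _ j).trans (hD ν v))
      ((hf ν).mono fun v hv => (norm_le_pi_norm _ j).trans hv) hη hηC hηε hMη
      (hμ ν ((i₀ ν).castAdd m)) (hτ ν ν.2 (i₀ ν) j))
  filter_upwards [eventually_all.2 fun ν => eventually_all.2 (htaylor ν),
    tendsto_norm_int_cofinite.eventually_ge_atTop 1] with b hb hb1 hlarge hshear y hy ν i
  cases i using Fin.addCases with
  | left i =>
    rw [residual_param_castAdd]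
    exact (hy ν i).trans_lt (by gcongr)
  | right j =>
    rw [residual_param_natAdd]
    have hhead {z : QS S d} {c : ℝ} (hc : 0 ≤ c) (hz : z ∈ baseBox S τ b c) :
        ‖(b 0 : ℚ_[(ν.1 : ℕ)]) • z ν - fun i => (b (i.castAdd m).succ : ℚ_[(ν.1 : ℕ)])‖ ≤
          c * ‖b‖ ^ (-τ ν ((i₀ ν).castAdd m)) :=
      (pi_norm_le_iff_of_nonneg (by positivity)).2 fun i => (hz ν i).trans (by
        gcongr
        exact hi₀ ν i)
    refine hb ν j (b 0) (fun i => b (i.castAdd m).succ) (b (j.natAdd d).succ) (hlarge.2 ν)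
      (hhead (hη.le.trans hηC) fun σ i => ?_) ?_ (y ν) (hhead hη.le hy)
    · simpa only [shear_castAdd, Fin.append_left, residual_param_castAdd]
        using hshear σ (i.castAdd m)
    · have htail := hshear ν (j.natAdd d)
      simp only [shear_natAdd, Fin.append_right, residual_param_natAdd,
        residual_param_castAdd] at htail
      exact htail

theorem exists_infinite_controlsBox (hd : d ≠ 0) (hτ : IsWeight S τ)
    (hτ_dom : ∀ ν ∈ S, ∀ (i : Fin d) (j : Fin m), τ ν (j.natAdd d) ≤ τ ν (i.castAdd m))
    {μ : S → ℝ} (hμ : ∀ ν i, μ ν < τ ν i) {x : QS S d}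
    (hf : ∀ ν : S, HasQuadraticApproxAt ℚ_[(ν.1 : ℕ)] (f ν) (x ν))
    (hx : ∀ ν, HasLargeHeads S τ ν (μ ν) (param S f x)) {ε : ℝ} (hε : 0 < ε) :
    ∃ N C : ℕ, 0 < C ∧ {b ∈ largeHeads S (d + m) μ ∩
      {b | ControlsBox S f τ ε (1 / ((N : ℝ) + 1)) b} | x ∈ baseBox S τ b C}.Infinite := by
  choose D hD using fun ν => (hf ν).exists_eventually
  obtain ⟨M, hMD, hM⟩ := ((eventually_all.2 hD).and (eventually_ge_atTop 1)).exists
  have hM0 : 0 < M := one_pos.trans_le hM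
  obtain ⟨N, hN⟩ := exists_nat_one_div_lt (div_pos hε hM0)
  set η := 1 / ((N : ℝ) + 1)
  have hη : 0 < η := Nat.one_div_pos_of_nat
  have hMη : M * η < ε := (lt_div_iff₀' hM0).1 hN
  obtain ⟨C, hC, hinf⟩ := exists_infinite_norm_le_append hd hτ
    ((shear D).comp (residual (param S f x))) hη
  have hC' : (1 : ℝ) ≤ C := Nat.one_le_cast.2 hC
  have hηC : η ≤ C := (Nat.one_div_le_one_div (Nat.zero_le N)).trans (by simpa using hC')
  refine ⟨N, C, hC, ?_⟩
  have hlarge := eventually_all.2 fun ν => hx ν (M * C)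
  have hbox := eventually_controlsBox hd hμ hτ_dom hM0.le (fun ν => (hMD ν).1)
    (fun ν => (hMD ν).2) hη hηC ((le_mul_of_one_le_left hη.le hM).trans_lt hMη) hMη
  refine frequently_cofinite_iff_infinite.1
    ((frequently_cofinite_iff_infinite.2 hinf).and_eventually
      ((tendsto_norm_int_cofinite.eventually_ge_atTop 1).and (hlarge.and hbox)) |>.mono ?_)
  rintro b ⟨hb, hb1, hlarge, hbox⟩
  have hb_large : b ∈ largeHeads S (d + m) μ :=
    ⟨norm_pos_iff.1 (one_pos.trans_le hb1), fun ν => hlarge ν fun σ i =>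
      norm_le_of_norm_shear_le hM hηC hb1 (by positivity) (fun ν => (hMD ν).1) hτ_dom hb σ i⟩
  refine ⟨⟨hb_large, hbox hb_large hb⟩, fun ν i => ?_⟩
  simpa only [shear_castAdd, Fin.append_left, residual_param_castAdd, AddMonoidHom.comp_apply]
    using hb ν (i.castAdd m)

theorem ae_param_mem_W (hd : d ≠ 0) (hτ : IsWeight S τ)
    (hτ_dom : ∀ ν ∈ S, ∀ (i : Fin d) (j : Fin m), τ ν (j.natAdd d) ≤ τ ν (i.castAdd m))
    {μ : S → ℝ} (hμ : ∀ ν i, μ ν < τ ν i) {ε : ℝ} (hε : 0 < ε) :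
    ∀ᵐ x ∂haar S d, (∀ ν : S, HasQuadraticApproxAt ℚ_[(ν.1 : ℕ)] (f ν) (x ν)) →
      param S f x ∈ ZS S (d + m) → (∀ ν, HasLargeHeads S τ ν (μ ν) (param S f x)) →
      param S f x ∈ W S τ ε := by
  have hcover := ae_all_iff.2 fun N : ℕ => ae_all_iff.2 fun C : ℕ => ae_all_iff.2 fun hC : 0 < C =>
    ae_infinite_largeHeads hμ (Nat.cast_pos.2 hC) (Nat.one_div_pos_of_nat (n := N))
      {b | ControlsBox S f τ ε (1 / ((N : ℝ) + 1)) b}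
  filter_upwards [hcover] with x hx hf hZ hlarge
  obtain ⟨N, C, hC, hinf⟩ := exists_infinite_controlsBox hd hτ hτ_dom hμ hf hlarge hε
  exact ⟨hZ, (hx N C hC hinf).mono fun b hb => hb.1 x hb.2⟩

end Approximation

end SArith

end

theorem theorem8p6_general (S : Finset Nat.Primes) (d m : ℕ) (hd : 1 ≤ d)
    (U : ∀ ν : Nat.Primes, Set (Fin d → ℚ_[(ν : ℕ)]))
    (f : ∀ ν : Nat.Primes, (Fin d → ℚ_[(ν : ℕ)]) → (Fin m → ℚ_[(ν : ℕ)]))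
    (hf : ∀ ν ∈ S, ∀ x ∈ U ν, SArith.HasQuadraticApproxAt ℚ_[(ν : ℕ)] (f ν) x)
    (τ : Nat.Primes → Fin (d + m) → ℝ) (hτ : SArith.IsWeight S τ)
    (hτ_dom : ∀ ν ∈ S, ∀ (i : Fin d) (j : Fin m), τ ν (Fin.natAdd d j) ≤ τ ν (Fin.castAdd m i))
    (h : ∀ ν ∈ S, (⨅ i, τ ν i) ≤ 1 →
      SArith.manifoldExponent (S.erase ν) U f (SArith.rescale τ ν) < SArith.exponentBound τ ν) :
    SArith.haar S d {x | x ∈ SArith.domain S U ∧ SArith.param S f x ∈ SArith.Bad S τ} = 0 := by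
  have : NeZero (d + m) := ⟨by lia⟩
  choose μ hμ hlarge using fun ν : S => SArith.exists_ae_hasLargeHeads hτ ν (h ν ν.2)
  have hW := ae_all_iff.2 fun ℓ : ℕ => SArith.ae_param_mem_W (f := f) (by lia) hτ hτ_dom hμ
    (Nat.one_div_pos_of_nat (n := ℓ))
  refine measure_eq_zero_iff_ae_notMem.2 ?_
  filter_upwards [ae_all_iff.2 hlarge, hW] with x hlarge hW
  rintro ⟨hxU, hxZ, hxW⟩
  exact hxW (Set.mem_iInter.2 fun ℓ =>
    hW ℓ (fun ν => hf ν ν.2 (x ν) (hxU ν)) hxZ fun ν => hlarge ν hxU hxZ)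

theorem theorem8p6 (S : Finset Nat.Primes) (d m : ℕ) (hd : 1 ≤ d)
    (U : ∀ ν : Nat.Primes, Set (Fin d → ℚ_[(ν : ℕ)]))
    (f : ∀ ν : Nat.Primes, (Fin d → ℚ_[(ν : ℕ)]) → (Fin m → ℚ_[(ν : ℕ)]))
    (hU : ∀ ν ∈ S, IsOpen (U ν))
    (hUZ : ∀ ν ∈ S, ∀ x ∈ U ν, ∀ i, ‖x i‖ ≤ 1)
    (hfZ : ∀ ν ∈ S, ∀ x ∈ U ν, ∀ j, ‖f ν x j‖ ≤ 1)
    (hf : ∀ ν ∈ S, SArith.IsC2On ℚ_[(ν : ℕ)] (f ν) (U ν))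
    (τ : Nat.Primes → Fin (d + m) → ℝ)
    (hτ : SArith.IsWeight S τ)
    (hτ_dom : ∀ ν ∈ S, ∀ (i : Fin d) (j : Fin m), τ ν (Fin.natAdd d j) ≤ τ ν (Fin.castAdd m i))
    (hτ_dist : ∀ ν ∈ S, ∀ j, 1 / (((d + m : ℕ) : ℝ) + 1) * ∑ i, τ ν i < τ ν j) :
    ((∀ ν ∈ S, (⨅ i, τ ν i) ≤ 1 →
        SArith.manifoldExponent (S.erase ν) U f (SArith.rescale τ ν) <
          SArith.exponentBound τ ν) →
      SArith.haar S d {x | x ∈ SArith.domain S U ∧ SArith.param S f x ∈ SArith.Bad S τ} = 0) ∧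
    ((∀ ν ∈ S, (⨅ i, τ ν i) ≤ 1 → SArith.StronglyExtremal (S.erase ν) U f) →
      SArith.haar S d {x | x ∈ SArith.domain S U ∧ SArith.param S f x ∈ SArith.Bad S τ} = 0) := by
  have : NeZero (d + m) := ⟨by lia⟩
  simp_rw [one_div_mul_eq_div] at hτ_dist
  have hnull := theorem8p6_general S d m hd U f
    (fun ν hν x hx => (hf ν hν).hasQuadraticApproxAt (hU ν hν) hx) τ hτ hτ_dom
  exact ⟨hnull, fun h => hnull fun ν hν hmin =>
    (h ν hν hmin).manifoldExponent_lt hτ hτ_dist hν hmin⟩
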